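/- **Setting.** Let $n,d\ge 1$, $\gamma\in(0,1]$, $c>0$, $\sigma>0$. Client $i\in\{1,\dots,n\}$ holds $x_i\in\mathbb R^d$. *Shifted layered quantizer.* For a unimodal density $f$ with maximum $\bar Z$, let $b^-(t)=\inf\{u: f(u)\ge t\}$, $b^+(t)=\sup\{u: f(u)\ge t\}$ and $f_W(t)=(b^+(t)-b^-(\bar Z-t))\mathbf 1_{(0,\bar Z)}(t)$. The shared randomness is $S=(U,W)$ with $U\sim\mathcal U(0,1)$ independent of $W\sim f_W$; the encoder is $\mathscr E(X,S)=\lfloor X/f_W(W)+U+1/2\rfloor$ and the decoder is $\mathscr D(M,S)=(M-U)f_W(W)+\tfrac12(b^+(W)+b^-(\bar Z-W))$. *SIGM.* Let $f$ be the density of $\mathcal N(0,(\sigma\gamma n)^2)$. Draw independent $B_i(j)\sim\mathrm{Bernoulli}(\gamma)$ and independent copies $S_i(j)$ of $S$, and put $\tilde n(j)=\sum_i B_i(j)$. If $B_i(j)=1$, client $i$ sends $M_i(j)=\mathscr E(x_i(j)\sqrt{\tilde n(j)},S_i(j))$ for coordinate $j$, otherwise nothing. The server outputs $$Y(j)=\frac{1}{\gamma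 n\sqrt{\tilde n(j)}}\sum_{i:B_i(j)=1}\mathscr D(M_i(j),S_i(j))\quad\text{if }\tilde n(j)\ge1,$$ and an independent $\mathcal N(0,\sigma^2)$ variable as $Y(j)$ if $\tilde n(j)=0$. The cost of a client is the expected number of bits it sends when each description for a coordinate $j$ that it was selected for is coded with $\lceil\log_2|\mathcal M_j|\rceil$ bits, where $\mathcal M_j$ is the set of all values $\mathscr E(X,(u,w))$ with $|X|\le c\sqrt{\tilde n(j)}$, $u\in(0,1)$, $w\in(0,\bar Z)$. **Claim.** (1) For all $x_1,\dots,x_n\in\mathbb R^d$, the error $\big(Y(j)-(\gamma n)^{-1}\sum_{i:B_i(j)=1}x_i(j)\big)_{j}$ has exactly the law $\mathcal N(0,\sigma^2 I_d)$ and is independent of $(B_i(j))_{i,j}$. (2) If $x_1,\dots,x_n\in[-c,c]^d$, then $\mathbb E\,\|Y-n^{-1}\sum_i x_i\|_2^2\le \dfrac{dc^2}{n\gamma}+d\sigma^2$. (3) If $x_1,\dots,x_n\in[-c,c]^d$, then the sets $\mathcal M_j$ are finite and almost surely contain the descriptions sent for coordinate $j$. (4) There is a universal constant $K$ and, for every $\delta_0\in(0,1)$,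 a constant $C>0$ depending only on $\delta_0$, such that for all $n,d,\gamma,c$ as above, all $\varepsilon>0$ and $\delta\in(0,\delta_0]$, and every $\sigma>0$ with $$\sigma^2\ \ge\ C\left(\frac{c^2\ln(1/\delta)}{n^2\gamma^2}+\frac{c^2d\,(\ln(d/\delta)+\varepsilon)\ln(d/\delta)}{n^2\varepsilon^2}\right)$$ (in particular with equality, a noise level of exactly this order), the output $Y$ of SIGM is $(\varepsilon,\delta)$-differentially private on $([-c,c]^d)^n$, where two datasets are adjacent if they differ in the vector of at most one client; and the cost of each client is at most $K\,\gamma d\log_2\!\big(2+c/(\sigma\sqrt{n\gamma})\big)$. -/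

import Mathlib

open MeasureTheory ProbabilityTheory

namespace SIGM

noncomputable section

/-! ### Differential privacy -/

/-- A randomized algorithm, given by the law `A D` of its output on each dataset `D`, is
`(ε, δ)`-differentially private with respect to the adjacency relation `adj`. -/
def IsDP {X Y : Type*} [MeasurableSpace Y] (adj : X → X → Prop) (A : X → Measure Y)
    (ε δ : ℝ) : Prop :=
  ∀ D₁ D₂ : X, adj D₁ D₂ → ∀ E : Set Y, MeasurableSet E →
    A D₁ E ≤ ENNReal.ofReal (Real.exp ε) * A D₂ E + ENNReal.ofReal δ

/-- Datasets of `n` clients, each holding a vector of `[-c, c]^d`. -/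
abbrev BoxData (n d : ℕ) (c : ℝ) : Type :=
  {x : Fin n → Fin d → ℝ // ∀ i j, x i j ∈ Set.Icc (-c) c}

/-- Two datasets are adjacent when they differ in the vector of at most one client. -/
def Adjacent {n d : ℕ} {c : ℝ} (x x' : BoxData n d c) : Prop :=
  ∃ i : Fin n, ∀ k : Fin n, k ≠ i → x.1 k = x'.1 k

/-! ### The shifted layered quantizer of a unimodal density `f` -/

/-- The superlevel set `{u | f u ≥ x}`. -/
def superlevel (f : ℝ → ℝ) (x : ℝ) : Set ℝ := {u | x ≤ f u}

/-- The left end of the superlevel set. -/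
def bMinus (f : ℝ → ℝ) (x : ℝ) : ℝ := sInf (superlevel f x)

/-- The right end of the superlevel set. -/
def bPlus (f : ℝ → ℝ) (x : ℝ) : ℝ := sSup (superlevel f x)

/-- The maximum of the density. -/
def peak (f : ℝ → ℝ) : ℝ := ⨆ u, f u

/-- The density `f_W` of the layer `W`; its value at `W` is also the step size. -/
def shiftedStep (f : ℝ → ℝ) : ℝ → ℝ :=
  (Set.Ioo 0 (peak f)).indicator fun x => bPlus f x - bMinus f (peak f - x)

/-- The law of the shared randomness `S = (U, W)`: `U` is uniform on `(0, 1)` and independent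
of `W`, which has density `f_W`. -/
def quantizerLaw (f : ℝ → ℝ) : Measure (ℝ × ℝ) :=
  (volume.restrict (Set.Ioo (0 : ℝ) 1)).prod
    (volume.withDensity fun x => ENNReal.ofReal (shiftedStep f x))

/-- The encoder: `round y = ⌊y + 1/2⌋`. -/
def encode (f : ℝ → ℝ) (X : ℝ) (s : ℝ × ℝ) : ℤ := round (X / shiftedStep f s.2 + s.1)

/-- The decoder. -/
def decode (f : ℝ → ℝ) (m : ℤ) (s : ℝ × ℝ) : ℝ :=
  ((m : ℝ) - s.1) * shiftedStep f s.2 + (bPlus f s.2 + bMinus f (peak f - s.2)) / 2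

/-- All descriptions that the encoder can produce for an input in `[-r, r]`. -/
def descriptions (f : ℝ → ℝ) (r : ℝ) : Set ℤ :=
  {m | ∃ X ∈ Set.Icc (-r) r, ∃ u ∈ Set.Ioo (0 : ℝ) 1, ∃ w ∈ Set.Ioo 0 (peak f),
    encode f X (u, w) = m}

/-! ### The subsampled individual Gaussian mechanism -/

/-- The density of `N(0, (σ γ n)²)`, the error distribution of each single quantizer. -/
def noisePDF (n : ℕ) (γ σ : ℝ) : ℝ → ℝ := gaussianPDFReal 0 ((σ * γ * n) ^ 2).toNNReal

/-- All randomness of the mechanism: the selection variables `B i j`, the randomness `S i j`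
shared by client `i` and the server for coordinate `j`, and fresh server noise `G j`, which is
used only for a coordinate that no client was selected for. -/
abbrev Randomness (n d : ℕ) : Type :=
  (Fin n → Fin d → Bool) × (Fin n → Fin d → ℝ × ℝ) × (Fin d → ℝ)

/-- The law of the selection variables: i.i.d. Bernoulli(`γ`). -/
def selectionLaw (n d : ℕ) (γ : unitInterval) : Measure (Fin n → Fin d → Bool) :=
  Measure.pi fun _ => Measure.pi fun _ => bernoulliMeasure true false γ

/-- The law `N(0, σ² I_d)`. -/
def gaussianVec (d : ℕ) (σ : ℝ) : Measure (Fin d → ℝ) :=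
  Measure.pi fun _ => gaussianReal 0 (σ ^ 2).toNNReal

/-- The joint law of all randomness; everything is independent. -/
def randomnessLaw (n d : ℕ) (γ : unitInterval) (σ : ℝ) : Measure (Randomness n d) :=
  (selectionLaw n d γ).prod
    ((Measure.pi fun _ => Measure.pi fun _ => quantizerLaw (noisePDF n γ σ)).prod
      (gaussianVec d σ))

/-- The number `ñ(j)` of clients selected for coordinate `j`. -/
def numSelected {n d : ℕ} (B : Fin n → Fin d → Bool) (j : Fin d) : ℕ :=
  (Finset.univ.filter fun i => B i j = true).card

/-- The description `M_i(j)` that client `i` computes for coordinate `j`. -/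
def message {n d : ℕ} (γ σ : ℝ) (x : Fin n → Fin d → ℝ) (B : Fin n → Fin d → Bool)
    (S : Fin n → Fin d → ℝ × ℝ) (i : Fin n) (j : Fin d) : ℤ :=
  if B i j = true then encode (noisePDF n γ σ) (x i j * √(numSelected B j : ℝ)) (S i j) else 0

/-- The server: it sees the descriptions `M` and the randomness, not the data. -/
def serverDecode {n d : ℕ} (γ σ : ℝ) (M : Fin n → Fin d → ℤ) (ω : Randomness n d) :
    Fin d → ℝ := fun j =>
  if numSelected ω.1 j = 0 then ω.2.2 j
  else (γ * n * √(numSelected ω.1 j : ℝ))⁻¹ *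
    ∑ i, if ω.1 i j = true then decode (noisePDF n γ σ) (M i j) (ω.2.1 i j) else 0

/-- The output `Y` of the mechanism. -/
def output {n d : ℕ} (γ σ : ℝ) (x : Fin n → Fin d → ℝ) (ω : Randomness n d) : Fin d → ℝ :=
  serverDecode γ σ (message γ σ x ω.1 ω.2.1) ω

/-- The law of the output. -/
def outputLaw {n d : ℕ} (γ : unitInterval) (σ : ℝ) (x : Fin n → Fin d → ℝ) :
    Measure (Fin d → ℝ) :=
  (randomnessLaw n d γ σ).map (output γ σ x)

/-- The subsampled estimate `(γ n)⁻¹ ∑_{i : B_i(j) = 1} x_i(j)` of the mean. -/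
def subsampledMean {n d : ℕ} (γ : ℝ) (x : Fin n → Fin d → ℝ) (B : Fin n → Fin d → Bool) :
    Fin d → ℝ := fun j =>
  (γ * n)⁻¹ * ∑ i, if B i j = true then x i j else 0

/-- The squared Euclidean distance `‖Y - n⁻¹ ∑ i, x_i‖²`. -/
def sqError {n d : ℕ} (γ σ : ℝ) (x : Fin n → Fin d → ℝ) (ω : Randomness n d) : ℝ :=
  ∑ j, (output γ σ x ω j - (n : ℝ)⁻¹ * ∑ i, x i j) ^ 2

/-- The set of descriptions possible for coordinate `j` of a selected client with data in
`[-c, c]`. -/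
def alphabet {n d : ℕ} (γ σ c : ℝ) (B : Fin n → Fin d → Bool) (j : Fin d) : Set ℤ :=
  descriptions (noisePDF n γ σ) (c * √(numSelected B j : ℝ))

/-- The number of bits client `i` sends, with a fixed-length code of `⌈log₂ |alphabet|⌉` bits
for each coordinate that it was selected for, and nothing for the others. -/
def clientBits {n d : ℕ} (γ σ c : ℝ) (i : Fin n) (B : Fin n → Fin d → Bool) : ℕ :=
  ∑ j, if B i j = true then Nat.clog 2 (alphabet γ σ c B j).ncard else 0

/-- The order of the noise variance. -/
def noiseLevel (n d : ℕ) (γ c ε δ : ℝ) : ℝ :=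
  c ^ 2 * Real.log (1 / δ) / (n ^ 2 * γ ^ 2) +
    c ^ 2 * d * (Real.log (d / δ) + ε) * Real.log (d / δ) / (n ^ 2 * ε ^ 2)

end

end SIGM

/-!
Given the layer `W = w`, the dithered rounding error is uniform on the interval
`(b⁻(Z - w), b⁺(w))`, whose length is the density of `W` at `w`. The set of layers whose interval
contains `e` has measure `f e`, so the quantization error has density exactly `f`, whatever the
input (`map_quantError`). For a fixed selection the server thus averages `ñ` independent
`N(0, (σγn)²)` errors, and the scaling by `√ñ` gives `N(0, σ²)` for every `ñ`
(`measurePreserving_error`). The mean squared error splits into the variance of this noise and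
that of the subsampling.

For the cost, the steps are at least `σγn`, so an alphabet has at most `2 c√ñ / (σγn) + 3`
elements, and the concavity of the logarithm bounds the expected code length by that for
`ñ = 1 + nγ`, which bounds the mean of `ñ` given that the client is selected. When `nγ < 1` this uses `c / (σγn) ≤ 1`, which the noise level implies.

For privacy, the selection variables of all clients other than the one that changes are fixed. In
units of `σ`, up to a common shift, the coordinates of the output are independent with laws
`(1 - γ) N(0, 1) + γ N(a, 1)`, where `|a| ≤ h = c / (σγn)`. With `p` and `q` the densities of two
such laws, `L = log (1 / δ)` and `t = 2 (L + 1) / ε`, the multiple `t log (p / q)` of the privacy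
loss is clipped at the level `1 + |z|`, which depends on the noise value `z`. This level is low
enough for a second-order expansion of the moment generating function, giving `1 + O((t + t²) γ² h²)`
per coordinate without any truncation of `z` (`lintegral_exp_clipped_loss_le`). It is high enough
that exceeding it has probability `O(δ / d)`: since `t γ h` is at most a small multiple of `1 / √d`,
an excess forces `exp (2 h |z|)` to be large, while `h² L` is small (`mixLaw_clipped_le`). A union bound
for the excesses and a Chernoff bound for the sum of the clipped losses give `(ε, δ)`
(`pi_withDensity_apply_le`, `pi_mixLaw_apply_le`).
-/

namespace SIGM

/-! ### Finite product measures -/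

lemma lintegral_pi_prod {ι : Type*} [Fintype ι] {α : ι → Type*} [∀ i, MeasurableSpace (α i)]
    (μ : ∀ i, Measure (α i)) [∀ i, IsProbabilityMeasure (μ i)] {f : ∀ i, α i → ENNReal}
    (hf : ∀ i, Measurable (f i)) :
    ∫⁻ x, ∏ i, f i (x i) ∂Measure.pi μ = ∏ i, ∫⁻ a, f i a ∂μ i := by
  rw [lintegral_prod_eq_prod_lintegral_of_indepFun Finset.univ (fun i (x : ∀ i, α i) => f i (x i))
    (iIndepFun_pi fun i => (hf i).aemeasurable) fun i => (hf i).comp (measurable_pi_apply i)]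
  exact Finset.prod_congr rfl fun i _ => (measurePreserving_eval μ i).lintegral_comp (hf i)

lemma pi_withDensity {ι : Type*} [Fintype ι] {α : ι → Type*} [∀ i, MeasurableSpace (α i)]
    (μ : ∀ i, Measure (α i)) [∀ i, IsProbabilityMeasure (μ i)] {f : ∀ i, α i → ENNReal}
    (hf : ∀ i, Measurable (f i)) [∀ i, SigmaFinite ((μ i).withDensity (f i))] :
    Measure.pi (fun i => (μ i).withDensity (f i)) =
      (Measure.pi μ).withDensity fun x => ∏ i, f i (x i) := by
  refine Measure.pi_eq (μ := fun i => (μ i).withDensity (f i)) fun s hs => ?_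
  rw [withDensity_apply _ (MeasurableSet.univ_pi hs), ← lintegral_indicator (MeasurableSet.univ_pi hs)]
  calc _ = ∫⁻ x, ∏ i, (s i).indicator (f i) (x i) ∂Measure.pi μ := by
        congr with x
        by_cases hx : x ∈ Set.univ.pi s
        · rw [Set.indicator_of_mem hx]
          exact Finset.prod_congr rfl fun i _ => (Set.indicator_of_mem (hx i trivial) _).symm
        · rw [Set.indicator_of_notMem hx]
          simp only [Set.mem_univ_pi, not_forall] at hx
          obtain ⟨i, hi⟩ := hx
          exact (Finset.prod_eq_zero (Finset.mem_univ i) (Set.indicator_of_notMem hi _)).symm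
    _ = _ := by
        rw [lintegral_pi_prod μ fun i => (hf i).indicator (hs i)]
        refine Finset.prod_congr rfl fun i _ => ?_
        rw [lintegral_indicator (hs i), withDensity_apply _ (hs i)]

/-- Transposing an array of independent entries: both arrays have the law of the family indexed by
pairs. -/
lemma pi_pi_map_swap {ι κ α : Type*} [Fintype ι] [Fintype κ] [MeasurableSpace α]
    (μ : Measure α) [IsProbabilityMeasure μ] :
    (Measure.pi fun _ : ι => Measure.pi fun _ : κ => μ).map (fun x (j : κ) (i : ι) => x i j) =
      Measure.pi fun _ : κ => Measure.pi fun _ : ι => μ := by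
  have h₁ : (Measure.pi fun _ : ι => Measure.pi fun _ : κ => μ).map
      (fun x (p : κ × ι) => x p.2 p.1) = Measure.pi fun _ : κ × ι => μ := by
    symm
    refine Measure.pi_eq fun s hs => ?_
    rw [Measure.map_apply (by fun_prop) (MeasurableSet.univ_pi hs)]
    have : (fun (x : ι → κ → α) (p : κ × ι) => x p.2 p.1) ⁻¹' Set.univ.pi s =
        Set.univ.pi fun i => Set.univ.pi fun j => s (j, i) := by
      ext x
      simp only [Set.mem_preimage, Set.mem_univ_pi, Prod.forall]
      exact forall_comm
    rw [this, Measure.pi_pi, Fintype.prod_prod_type_right]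
    simp_rw [Measure.pi_pi]
  have h₂ : (Measure.pi fun _ : κ => Measure.pi fun _ : ι => μ).map
      (fun x (p : κ × ι) => x p.1 p.2) = Measure.pi fun _ : κ × ι => μ := by
    symm
    refine Measure.pi_eq fun s hs => ?_
    rw [Measure.map_apply (by fun_prop) (MeasurableSet.univ_pi hs)]
    have : (fun (x : κ → ι → α) (p : κ × ι) => x p.1 p.2) ⁻¹' Set.univ.pi s =
        Set.univ.pi fun j => Set.univ.pi fun i => s (j, i) := by
      ext x
      simp only [Set.mem_preimage, Set.mem_univ_pi, Prod.forall]
    rw [this, Measure.pi_pi, Fintype.prod_prod_type]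
    simp_rw [Measure.pi_pi]
  have h₃ := congrArg (Measure.map fun (y : κ × ι → α) (j : κ) (i : ι) => y (j, i)) (h₁.trans h₂.symm)
  rw [Measure.map_map (by fun_prop) (by fun_prop), Measure.map_map (by fun_prop) (by fun_prop)] at h₃
  exact h₃.trans Measure.map_id

/-- A linear combination of independent centred Gaussians is Gaussian. -/
lemma gaussian_pi_map_sum {ι : Type*} [Fintype ι] (v : NNReal) (c : ι → ℝ) :
    (Measure.pi fun _ : ι => gaussianReal 0 v).map (fun x => ∑ i, c i * x i) =
      gaussianReal 0 ((∑ i, (c i) ^ 2) * v).toNNReal := by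
  have hX : HasGaussianLaw (fun x : ι → ℝ => ∑ i, c i * x i)
      (Measure.pi fun _ : ι => gaussianReal 0 v) := by
    refine iIndepFun.hasGaussianLaw_fun_sum (X := fun i (x : ι → ℝ) => c i * x i) (fun i => ?_) ?_
    · constructor
      have : (fun x : ι → ℝ => c i * x i) = (fun y => c i * y) ∘ fun x => x i := rfl
      rw [this, ← Measure.map_map (by fun_prop) (by fun_prop),
        (measurePreserving_eval (fun _ : ι => gaussianReal 0 v) i).map_eq,
        gaussianReal_map_const_mul]
      infer_instance
    · exact iIndepFun_pi (X := fun i (y : ℝ) => c i * y) fun i => by fun_prop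
  rw [hX.map_eq_gaussianReal]
  have hint : ∀ i, Integrable (fun y : ℝ => c i * y) (gaussianReal 0 v) := fun i =>
    ((memLp_id_gaussianReal 1).integrable le_rfl).const_mul _
  congr 1
  · rw [integral_finsetSum _ fun i _ => integrable_comp_eval (hint i)]
    refine Finset.sum_eq_zero fun i _ => ?_
    rw [integral_comp_eval (μ := fun _ : ι => gaussianReal 0 v) (f := fun y : ℝ => c i * y)
        (hint i).aestronglyMeasurable,
      integral_const_mul, integral_id_gaussianReal, mul_zero]
  · congr 1
    have := variance_sum_pi (μ := fun _ : ι => gaussianReal 0 v) (X := fun i (y : ℝ) => c i * y)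
      fun i => (memLp_id_gaussianReal 2).const_mul (c i)
    have e : (∑ i, fun ω : ι → ℝ => c i * ω i) = fun x => ∑ i, c i * x i := by
      ext x; simp
    rw [e] at this
    rw [this, Finset.sum_mul]
    refine Finset.sum_congr rfl fun i _ => ?_
    rw [variance_const_mul, variance_fun_id_gaussianReal]

/-! ### The error of the quantizer for a Gaussian density -/

/-- The rounding error of a dithered real number is uniform on `(-1/2, 1/2)`. -/
lemma lintegral_round_sub {G : ℝ → ENNReal} (y : ℝ) :
    ∫⁻ u in Set.Ioo (0 : ℝ) 1, G (round (y + u) - (y + u)) =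
      ∫⁻ t in Set.Ioo (-(1 / 2) : ℝ) (1 / 2), G t := by
  have hper := (isAddFundamentalDomain_Ioc one_pos (0 : ℝ)).setLIntegral_eq
    (isAddFundamentalDomain_Ioc one_pos (-y - 1 / 2 : ℝ))
    (fun u => G (round (y + u) - (y + u))) (by
      rintro ⟨_, k, rfl⟩ x
      have : ((⟨(fun n : ℤ => n • (1 : ℝ)) k, k, rfl⟩ : AddSubgroup.zmultiples (1 : ℝ)) +ᵥ x : ℝ) =
          k + x := by
        simp [AddSubgroup.vadd_def]
      simp only [this]
      rw [show y + (k + x) = y + x + (k : ℤ) by ring, round_add_intCast]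
      push_cast
      congr 1
      ring)
  rw [zero_add] at hper
  rw [setLIntegral_congr Ioo_ae_eq_Ioc, hper, ← setLIntegral_congr Ioo_ae_eq_Ioc,
    ← lintegral_indicator measurableSet_Ioo, ← lintegral_indicator measurableSet_Ioo]
  refine Eq.trans ?_ (lintegral_sub_left_eq_self (μ := volume) _ (-y))
  congr with u
  have hiff : u ∈ Set.Ioo (-y - 1 / 2) (-y - 1 / 2 + 1) ↔ -y - u ∈ Set.Ioo (-(1 / 2) : ℝ) (1 / 2) := by
    simp only [Set.mem_Ioo]
    constructor <;> rintro ⟨h₁, h₂⟩ <;> constructor <;> linarith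
  by_cases hu : u ∈ Set.Ioo (-y - 1 / 2) (-y - 1 / 2 + 1)
  · rw [Set.indicator_of_mem hu, Set.indicator_of_mem (hiff.1 hu)]
    have : round (y + u) = 0 := by
      rw [round_eq, Int.floor_eq_iff]
      push_cast
      constructor <;> linarith [hu.1, hu.2]
    rw [this]
    congr 1
    push_cast
    ring
  · rw [Set.indicator_of_notMem hu, Set.indicator_of_notMem (mt hiff.2 hu)]

lemma lintegral_Ioo_affine {g : ℝ → ENNReal} (hg : Measurable g) {Δ : ℝ} (hΔ : 0 < Δ) (m : ℝ) :
    ENNReal.ofReal Δ * ∫⁻ t in Set.Ioo (-(1 / 2) : ℝ) (1 / 2), g (Δ * t + m) =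
      ∫⁻ e in Set.Ioo (m - Δ / 2) (m + Δ / 2), g e := by
  have hK : Measurable ((Set.Ioo (m - Δ / 2) (m + Δ / 2)).indicator g) :=
    hg.indicator measurableSet_Ioo
  have hiff : ∀ t, t ∈ Set.Ioo (-(1 / 2) : ℝ) (1 / 2) ↔
      Δ * t + m ∈ Set.Ioo (m - Δ / 2) (m + Δ / 2) := by
    intro t
    simp only [Set.mem_Ioo]
    constructor <;> rintro ⟨h₁, h₂⟩ <;> constructor <;> nlinarith
  have h₁ : ∫⁻ t in Set.Ioo (-(1 / 2) : ℝ) (1 / 2), g (Δ * t + m) =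
      ∫⁻ t, (Set.Ioo (m - Δ / 2) (m + Δ / 2)).indicator g (Δ * t + m) := by
    rw [← lintegral_indicator measurableSet_Ioo]
    congr with t
    by_cases ht : t ∈ Set.Ioo (-(1 / 2) : ℝ) (1 / 2)
    · rw [Set.indicator_of_mem ht, Set.indicator_of_mem ((hiff t).1 ht)]
    · rw [Set.indicator_of_notMem ht, Set.indicator_of_notMem (mt (hiff t).2 ht)]
  have h₂ := lintegral_map (μ := volume) (f := fun x => (Set.Ioo (m - Δ / 2) (m + Δ / 2)).indicator g (x + m))
    (hK.comp (measurable_add_const m)) (measurable_const_mul Δ)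
  rw [Real.map_volume_mul_left hΔ.ne', lintegral_smul_measure,
    lintegral_add_right_eq_self, lintegral_indicator measurableSet_Ioo, abs_of_pos (inv_pos.2 hΔ),
    smul_eq_mul] at h₂
  rw [h₁, ← h₂, ← mul_assoc, ← ENNReal.ofReal_mul hΔ.le, mul_inv_cancel₀ hΔ.ne', ENNReal.ofReal_one,
    one_mul]

section Gaussian

variable {v : NNReal}

lemma gaussianPDFReal_zero_eq (u : ℝ) :
    gaussianPDFReal 0 v u = (√(2 * Real.pi * v))⁻¹ * Real.exp (-u ^ 2 / (2 * v)) := by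
  rw [gaussianPDFReal, sub_zero]

lemma gaussianPDFReal_zero_le (u : ℝ) : gaussianPDFReal 0 v u ≤ (√(2 * Real.pi * v))⁻¹ := by
  rw [gaussianPDFReal_zero_eq]
  refine mul_le_of_le_one_right (by positivity) (Real.exp_le_one_iff.2 ?_)
  rw [neg_div]
  exact neg_nonpos.2 (by positivity)

lemma peak_gaussian : peak (gaussianPDFReal 0 v) = (√(2 * Real.pi * v))⁻¹ := by
  refine le_antisymm (ciSup_le gaussianPDFReal_zero_le) ?_
  refine le_ciSup_of_le ⟨_, Set.forall_mem_range.2 gaussianPDFReal_zero_le⟩ 0 ?_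
  rw [gaussianPDFReal_zero_eq]
  simp

lemma gaussianPDFReal_le_peak (u : ℝ) :
    gaussianPDFReal 0 v u ≤ peak (gaussianPDFReal 0 v) := by
  rw [peak_gaussian]
  exact gaussianPDFReal_zero_le u

lemma peak_gaussian_pos (hv : v ≠ 0) : 0 < peak (gaussianPDFReal 0 v) := by
  rw [peak_gaussian]
  have : (0 : ℝ) < v := NNReal.coe_pos.2 (pos_iff_ne_zero.2 hv)
  positivity

/-- Half the length of the superlevel set `{u | w ≤ f u}` of the Gaussian density `f`. -/
noncomputable def halfWidth (v : NNReal) (w : ℝ) : ℝ :=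
  √(2 * v * Real.log (peak (gaussianPDFReal 0 v) / w))

lemma le_gaussianPDFReal_iff (hv : v ≠ 0) {w : ℝ} (hw : 0 < w)
    (hw' : w ≤ peak (gaussianPDFReal 0 v)) (u : ℝ) :
    w ≤ gaussianPDFReal 0 v u ↔ |u| ≤ halfWidth v w := by
  have hv' : (0 : ℝ) < v := NNReal.coe_pos.2 (pos_iff_ne_zero.2 hv)
  have hZ := peak_gaussian_pos hv
  have hlog : 0 ≤ Real.log (peak (gaussianPDFReal 0 v) / w) :=
    Real.log_nonneg ((one_le_div hw).2 hw')
  rw [gaussianPDFReal_zero_eq, ← peak_gaussian, halfWidth,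
    Real.le_sqrt (abs_nonneg u) (mul_nonneg (by positivity) hlog), sq_abs,
    ← div_le_iff₀' hZ, ← Real.log_le_iff_le_exp (by positivity), Real.log_div hw.ne' hZ.ne',
    Real.log_div hZ.ne' hw.ne', le_div_iff₀ (by positivity)]
  constructor <;> intro h <;> linarith

lemma superlevel_gaussian (hv : v ≠ 0) {w : ℝ} (hw : 0 < w)
    (hw' : w ≤ peak (gaussianPDFReal 0 v)) :
    superlevel (gaussianPDFReal 0 v) w = Set.Icc (-halfWidth v w) (halfWidth v w) := by
  ext u
  rw [superlevel, Set.mem_ofPred_eq, le_gaussianPDFReal_iff hv hw hw', abs_le, Set.mem_Icc]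

lemma superlevel_of_nonpos {w : ℝ} (hw : w ≤ 0) :
    superlevel (gaussianPDFReal 0 v) w = Set.univ :=
  Set.eq_univ_of_forall fun u => hw.trans (gaussianPDFReal_nonneg 0 v u)

lemma superlevel_of_peak_lt {w : ℝ} (hw : peak (gaussianPDFReal 0 v) < w) :
    superlevel (gaussianPDFReal 0 v) w = ∅ :=
  Set.eq_empty_of_forall_notMem fun u hu => absurd (hu.trans (gaussianPDFReal_le_peak u)) hw.not_ge

lemma halfWidth_of_peak_lt (hv : v ≠ 0) {w : ℝ} (hw : peak (gaussianPDFReal 0 v) < w) :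
    halfWidth v w = 0 := by
  have hZ := peak_gaussian_pos hv
  have hw0 := hZ.trans hw
  refine Real.sqrt_eq_zero_of_nonpos (mul_nonpos_of_nonneg_of_nonpos (by positivity) ?_)
  exact Real.log_nonpos (by positivity) ((div_le_one hw0).2 hw.le)

lemma halfWidth_nonneg (w : ℝ) : 0 ≤ halfWidth v w := Real.sqrt_nonneg _

lemma halfWidth_pos (hv : v ≠ 0) {w : ℝ} (hw : w ∈ Set.Ioo 0 (peak (gaussianPDFReal 0 v))) :
    0 < halfWidth v w := by
  have hv' : (0 : ℝ) < v := NNReal.coe_pos.2 (pos_iff_ne_zero.2 hv)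
  have := Real.log_pos ((one_lt_div hw.1).2 hw.2)
  rw [halfWidth]
  positivity

lemma lt_halfWidth_iff (hv : v ≠ 0) {w : ℝ} (hw : 0 < w)
    {u : ℝ} (hu : 0 ≤ u) : u < halfWidth v w ↔ w < gaussianPDFReal 0 v u := by
  have hv' : (0 : ℝ) < v := NNReal.coe_pos.2 (pos_iff_ne_zero.2 hv)
  have hZ := peak_gaussian_pos hv
  rw [gaussianPDFReal_zero_eq, ← peak_gaussian, halfWidth, Real.lt_sqrt hu,
    ← div_lt_iff₀' hZ, ← Real.log_lt_iff_lt_exp (by positivity), Real.log_div hw.ne' hZ.ne',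
    Real.log_div hZ.ne' hw.ne', lt_div_iff₀ (by positivity)]
  constructor <;> intro h <;> linarith

lemma measurable_halfWidth : Measurable (halfWidth v) := by
  unfold halfWidth
  fun_prop

/-- For `w ≤ 0` the superlevel set is the whole line and its supremum is `0` by convention; for `w`
above the maximum both sides vanish. -/
lemma bPlus_gaussian_eq (hv : v ≠ 0) :
    bPlus (gaussianPDFReal 0 v) = (Set.Ioi 0).indicator (halfWidth v) := by
  ext w
  by_cases hw : 0 < w
  · rw [Set.indicator_of_mem (Set.mem_Ioi.2 hw)]
    by_cases hw' : w ≤ peak (gaussianPDFReal 0 v)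
    · rw [bPlus, superlevel_gaussian hv hw hw', csSup_Icc (neg_le_self (halfWidth_nonneg w))]
    · rw [bPlus, superlevel_of_peak_lt (not_le.1 hw'), Real.sSup_empty,
        halfWidth_of_peak_lt hv (not_le.1 hw')]
  · rw [Set.indicator_of_notMem (by simpa using hw), bPlus, superlevel_of_nonpos (not_lt.1 hw),
      Real.sSup_univ]

lemma bMinus_gaussian_eq (hv : v ≠ 0) :
    bMinus (gaussianPDFReal 0 v) = (Set.Ioi 0).indicator fun w => -halfWidth v w := by
  ext w
  by_cases hw : 0 < w
  · rw [Set.indicator_of_mem (Set.mem_Ioi.2 hw)]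
    by_cases hw' : w ≤ peak (gaussianPDFReal 0 v)
    · rw [bMinus, superlevel_gaussian hv hw hw', csInf_Icc (neg_le_self (halfWidth_nonneg w))]
    · rw [bMinus, superlevel_of_peak_lt (not_le.1 hw'), Real.sInf_empty,
        halfWidth_of_peak_lt hv (not_le.1 hw'), neg_zero]
  · rw [Set.indicator_of_notMem (by simpa using hw), bMinus, superlevel_of_nonpos (not_lt.1 hw),
      Real.sInf_univ]

lemma bPlus_gaussian (hv : v ≠ 0) {w : ℝ} (hw : 0 < w) :
    bPlus (gaussianPDFReal 0 v) w = halfWidth v w := by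
  rw [bPlus_gaussian_eq hv, Set.indicator_of_mem (Set.mem_Ioi.2 hw)]

lemma bMinus_gaussian (hv : v ≠ 0) {w : ℝ} (hw : 0 < w) :
    bMinus (gaussianPDFReal 0 v) w = -halfWidth v w := by
  rw [bMinus_gaussian_eq hv, Set.indicator_of_mem (Set.mem_Ioi.2 hw)]

lemma sub_mem_Ioo_peak {Z w : ℝ} (hw : w ∈ Set.Ioo 0 Z) : Z - w ∈ Set.Ioo 0 Z :=
  ⟨sub_pos.2 hw.2, sub_lt_self _ hw.1⟩

lemma shiftedStep_gaussian (hv : v ≠ 0) :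
    shiftedStep (gaussianPDFReal 0 v) = (Set.Ioo 0 (peak (gaussianPDFReal 0 v))).indicator
      fun w => halfWidth v w + halfWidth v (peak (gaussianPDFReal 0 v) - w) := by
  ext w
  by_cases hw : w ∈ Set.Ioo 0 (peak (gaussianPDFReal 0 v))
  · rw [shiftedStep, Set.indicator_of_mem hw, Set.indicator_of_mem hw, bPlus_gaussian hv hw.1,
      bMinus_gaussian hv (sub_mem_Ioo_peak hw).1, sub_neg_eq_add]
  · rw [shiftedStep, Set.indicator_of_notMem hw, Set.indicator_of_notMem hw]

lemma measurable_shiftedStep (hv : v ≠ 0) : Measurable (shiftedStep (gaussianPDFReal 0 v)) := by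
  rw [shiftedStep_gaussian hv]
  have := measurable_halfWidth (v := v)
  exact Measurable.indicator (by fun_prop) measurableSet_Ioo

/-- The steps are bounded below, since one of `w` and `Z - w` is at most half the maximum `Z`. -/
lemma sqrt_le_shiftedStep (hv : v ≠ 0) {w : ℝ} (hw : w ∈ Set.Ioo 0 (peak (gaussianPDFReal 0 v))) :
    √v ≤ shiftedStep (gaussianPDFReal 0 v) w := by
  rw [shiftedStep_gaussian hv, Set.indicator_of_mem hw]
  have key : ∀ t, 0 < t → t ≤ peak (gaussianPDFReal 0 v) / 2 → √v ≤ halfWidth v t := by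
    intro t ht ht'
    refine Real.sqrt_le_sqrt ?_
    have h2 : Real.log 2 ≤ Real.log (peak (gaussianPDFReal 0 v) / t) :=
      Real.log_le_log two_pos (by rw [le_div_iff₀ ht]; linarith)
    have := Real.log_two_gt_d9
    nlinarith [v.2]
  rcases le_total w (peak (gaussianPDFReal 0 v) / 2) with h | h
  · linarith [key w hw.1 h, halfWidth_nonneg (v := v) (peak (gaussianPDFReal 0 v) - w)]
  · linarith [key (peak (gaussianPDFReal 0 v) - w) (sub_pos.2 hw.2) (by linarith),
      halfWidth_nonneg (v := v) w]

lemma shiftedStep_pos (hv : v ≠ 0) {w : ℝ} (hw : w ∈ Set.Ioo 0 (peak (gaussianPDFReal 0 v))) :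
    0 < shiftedStep (gaussianPDFReal 0 v) w :=
  lt_of_lt_of_le (Real.sqrt_pos.2 (NNReal.coe_pos.2 (pos_iff_ne_zero.2 hv)))
    (sqrt_le_shiftedStep hv hw)

/-- The error `decode (encode X s) s - X` of the quantizer. -/
noncomputable def quantError (f : ℝ → ℝ) (X : ℝ) (s : ℝ × ℝ) : ℝ :=
  decode f (encode f X s) s - X

lemma quantError_gaussian (hv : v ≠ 0) (X u : ℝ) {w : ℝ}
    (hw : w ∈ Set.Ioo 0 (peak (gaussianPDFReal 0 v))) :
    quantError (gaussianPDFReal 0 v) X (u, w) =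
      shiftedStep (gaussianPDFReal 0 v) w *
        (round (X / shiftedStep (gaussianPDFReal 0 v) w + u) -
          (X / shiftedStep (gaussianPDFReal 0 v) w + u)) +
      (halfWidth v w - halfWidth v (peak (gaussianPDFReal 0 v) - w)) / 2 := by
  have hΔ := (shiftedStep_pos hv hw).ne'
  rw [quantError, decode, encode, bPlus_gaussian hv hw.1,
    bMinus_gaussian hv (sub_mem_Ioo_peak hw).1]
  field_simp
  ring

lemma measurable_quantError (hv : v ≠ 0) (X : ℝ) :
    Measurable (quantError (gaussianPDFReal 0 v) X) := by
  have h₁ := measurable_shiftedStep hv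
  have h₂ : Measurable (bPlus (gaussianPDFReal 0 v)) := by
    rw [bPlus_gaussian_eq hv]
    exact measurable_halfWidth.indicator measurableSet_Ioi
  have h₃ : Measurable (bMinus (gaussianPDFReal 0 v)) := by
    rw [bMinus_gaussian_eq hv]
    exact measurable_halfWidth.neg.indicator measurableSet_Ioi
  unfold quantError decode encode
  simp_rw [round_eq]
  fun_prop

/-- The set of layers whose error interval contains `e` has measure `f e`. -/
lemma volume_layers (hv : v ≠ 0) (e : ℝ) :
    volume (Set.Ioo 0 (peak (gaussianPDFReal 0 v)) ∩
      {w | -halfWidth v (peak (gaussianPDFReal 0 v) - w) < e ∧ e < halfWidth v w}) =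
      gaussianPDF 0 v e := by
  have heven : gaussianPDFReal 0 v (-e) = gaussianPDFReal 0 v e := by
    rw [gaussianPDFReal_zero_eq, gaussianPDFReal_zero_eq, neg_sq]
  rcases le_or_gt 0 e with he | he
  · have : Set.Ioo 0 (peak (gaussianPDFReal 0 v)) ∩
        {w | -halfWidth v (peak (gaussianPDFReal 0 v) - w) < e ∧ e < halfWidth v w} =
        Set.Ioo 0 (gaussianPDFReal 0 v e) := by
      ext w
      simp only [Set.mem_inter_iff, Set.mem_ofPred_eq]
      constructor
      · rintro ⟨hw, -, h⟩
        exact ⟨hw.1, (lt_halfWidth_iff hv hw.1 he).1 h⟩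
      · rintro ⟨h₁, h₂⟩
        have hw : w ∈ Set.Ioo 0 (peak (gaussianPDFReal 0 v)) := ⟨h₁, h₂.trans_le (gaussianPDFReal_le_peak e)⟩
        exact ⟨hw, by linarith [halfWidth_pos hv (sub_mem_Ioo_peak hw)],
          (lt_halfWidth_iff hv h₁ he).2 h₂⟩
    rw [this, Real.volume_Ioo, sub_zero, gaussianPDF]
  · have : Set.Ioo 0 (peak (gaussianPDFReal 0 v)) ∩
        {w | -halfWidth v (peak (gaussianPDFReal 0 v) - w) < e ∧ e < halfWidth v w} =
        Set.Ioo (peak (gaussianPDFReal 0 v) - gaussianPDFReal 0 v e)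
          (peak (gaussianPDFReal 0 v)) := by
      ext w
      simp only [Set.mem_inter_iff, Set.mem_ofPred_eq]
      constructor
      · rintro ⟨hw, h, -⟩
        have := (lt_halfWidth_iff hv (sub_mem_Ioo_peak hw).1 (neg_pos.2 he).le).1 (by linarith)
        exact ⟨by linarith, hw.2⟩
      · rintro ⟨h₁, h₂⟩
        have hw : w ∈ Set.Ioo 0 (peak (gaussianPDFReal 0 v)) :=
          ⟨by linarith [gaussianPDFReal_le_peak (v := v) e], h₂⟩
        have := (lt_halfWidth_iff hv (sub_mem_Ioo_peak hw).1 (neg_pos.2 he).le).2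
          (by rw [heven]; linarith)
        exact ⟨hw, by linarith, by linarith [halfWidth_pos hv hw]⟩
    rw [this, Real.volume_Ioo, sub_sub_cancel, gaussianPDF]

/-- The quantization error has exactly the law with density `f`, whatever the input: given the
layer `w`, it is uniform on an interval, and these intervals fill the region under the graph. -/
lemma map_quantError (hv : v ≠ 0) (X : ℝ) :
    (quantizerLaw (gaussianPDFReal 0 v)).map (quantError (gaussianPDFReal 0 v) X) =
      gaussianReal 0 v := by
  have hmeas := measurable_quantError hv X
  have hB := measurable_halfWidth (v := v)
  set Z := peak (gaussianPDFReal 0 v) with hZ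
  refine Measure.ext_of_lintegral _ fun g hg => ?_
  rw [lintegral_map hg hmeas, quantizerLaw, lintegral_prod_symm (fun s => g (quantError _ X s)) (hg.comp hmeas).aemeasurable,
    lintegral_withDensity_eq_lintegral_mul₀ (measurable_shiftedStep hv).ennreal_ofReal.aemeasurable
      (Measurable.lintegral_prod_left' (f := fun s => g (quantError _ X s))
        (hg.comp hmeas)).aemeasurable]
  have hset : MeasurableSet {p : ℝ × ℝ | -halfWidth v (Z - p.1) < p.2 ∧ p.2 < halfWidth v p.1} := by
    have h₁ : MeasurableSet {p : ℝ × ℝ | -halfWidth v (Z - p.1) < p.2} :=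
      measurableSet_lt (by fun_prop) (by fun_prop)
    have h₂ : MeasurableSet {p : ℝ × ℝ | p.2 < halfWidth v p.1} :=
      measurableSet_lt (by fun_prop) (by fun_prop)
    exact h₁.inter h₂
  have hF : Measurable fun p : ℝ × ℝ =>
      {p : ℝ × ℝ | -halfWidth v (Z - p.1) < p.2 ∧ p.2 < halfWidth v p.1}.indicator
        (fun p => g p.2) p := (hg.comp measurable_snd).indicator hset
  calc _ = ∫⁻ w in Set.Ioo 0 Z, ∫⁻ e,
        {p : ℝ × ℝ | -halfWidth v (Z - p.1) < p.2 ∧ p.2 < halfWidth v p.1}.indicator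
          (fun p => g p.2) (w, e) := by
        rw [← lintegral_indicator measurableSet_Ioo]
        congr with w
        by_cases hw : w ∈ Set.Ioo 0 Z
        · rw [Set.indicator_of_mem hw, Pi.mul_apply]
          simp_rw [quantError_gaussian hv X _ hw, ← hZ]
          rw [lintegral_round_sub (G := fun t => g (shiftedStep (gaussianPDFReal 0 v) w * t +
              (halfWidth v w - halfWidth v (Z - w)) / 2)),
            lintegral_Ioo_affine hg (shiftedStep_pos hv hw), ← lintegral_indicator measurableSet_Ioo]
          rw [shiftedStep_gaussian hv, Set.indicator_of_mem hw, ← hZ]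
          congr with e
          have : e ∈ Set.Ioo ((halfWidth v w - halfWidth v (Z - w)) / 2 -
              (halfWidth v w + halfWidth v (Z - w)) / 2)
              ((halfWidth v w - halfWidth v (Z - w)) / 2 +
              (halfWidth v w + halfWidth v (Z - w)) / 2) ↔
              (w, e) ∈ {p : ℝ × ℝ | -halfWidth v (Z - p.1) < p.2 ∧ p.2 < halfWidth v p.1} := by
            simp only [Set.mem_Ioo, Set.mem_ofPred_eq]
            constructor <;> rintro ⟨h₁, h₂⟩ <;> constructor <;> linarith
          simp only [Set.indicator, this]
        · rw [Set.indicator_of_notMem hw, Pi.mul_apply, shiftedStep_gaussian hv,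
            Set.indicator_of_notMem hw]
          simp
    _ = ∫⁻ e, ∫⁻ w in Set.Ioo 0 Z,
        {p : ℝ × ℝ | -halfWidth v (Z - p.1) < p.2 ∧ p.2 < halfWidth v p.1}.indicator
          (fun p => g p.2) (w, e) := lintegral_lintegral_swap hF.aemeasurable
    _ = ∫⁻ e, gaussianPDF 0 v e * g e := by
        congr with e
        have he : MeasurableSet {w | -halfWidth v (Z - w) < e ∧ e < halfWidth v w} :=
          hset.preimage (f := fun w : ℝ => (w, e)) (by fun_prop)
        rw [← volume_layers hv e, ← hZ, Set.inter_comm, ← Measure.restrict_apply he, mul_comm,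
          ← lintegral_indicator_const he]
        rfl
    _ = _ := by
        rw [gaussianReal_of_var_ne_zero _ hv,
          lintegral_withDensity_eq_lintegral_mul₀ (measurable_gaussianPDF 0 v).aemeasurable
            hg.aemeasurable]
        rfl

end Gaussian

/-! ### The law of the error -/

lemma isProbabilityMeasure_quantizerLaw {v : NNReal} (hv : v ≠ 0) :
    IsProbabilityMeasure (quantizerLaw (gaussianPDFReal 0 v)) := by
  constructor
  have h := congrArg (fun μ : Measure ℝ => μ Set.univ) (map_quantError hv 0)
  simpa [Measure.map_apply (measurable_quantError hv 0) MeasurableSet.univ] using h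

lemma measurePreserving_quantError {v : NNReal} (hv : v ≠ 0) (X : ℝ) :
    MeasurePreserving (quantError (gaussianPDFReal 0 v) X) (quantizerLaw (gaussianPDFReal 0 v))
      (gaussianReal 0 v) :=
  ⟨measurable_quantError hv X, map_quantError hv X⟩

instance (n d : ℕ) (γ : unitInterval) : IsProbabilityMeasure (selectionLaw n d γ) := by
  unfold selectionLaw
  infer_instance

instance (d : ℕ) (σ : ℝ) : IsProbabilityMeasure (gaussianVec d σ) := by
  unfold gaussianVec
  infer_instance

lemma noise_variance_ne_zero {n : ℕ} {γ σ : ℝ} (hn : 1 ≤ n) (hγ : 0 < γ) (hσ : 0 < σ) :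
    ((σ * γ * n) ^ 2).toNNReal ≠ 0 := by
  have : (0 : ℝ) < n := by exact_mod_cast hn
  rw [Ne, Real.toNNReal_eq_zero, not_le]
  positivity

/-- The server's estimation error for coordinate `j`, as a function of the errors `z i` of the
clients' quantizers and of the server noise `g`. -/
noncomputable def combineErrors {n d : ℕ} (γ : ℝ) (B : Fin n → Fin d → Bool) (j : Fin d)
    (p : (Fin n → ℝ) × ℝ) : ℝ :=
  if numSelected B j = 0 then p.2
  else ∑ i, (if B i j = true then (γ * n * √(numSelected B j : ℝ))⁻¹ else 0) * p.1 i

lemma output_sub_subsampledMean {n d : ℕ} (γ σ : ℝ) (x : Fin n → Fin d → ℝ)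
    (ω : Randomness n d) :
    output γ σ x ω - subsampledMean γ x ω.1 = fun j => combineErrors γ ω.1 j
      (fun i => quantError (noisePDF n γ σ) (x i j * √(numSelected ω.1 j : ℝ)) (ω.2.1 i j),
        ω.2.2 j) := by
  ext j
  rw [Pi.sub_apply, output, serverDecode, subsampledMean, combineErrors]
  split_ifs with h
  · have hB : ∀ i, ¬ ω.1 i j = true := by
      simpa [numSelected, Finset.filter_eq_empty_iff] using h
    simp [hB]
  · have hm : √(numSelected ω.1 j : ℝ) ≠ 0 :=
      (Real.sqrt_pos.2 (by exact_mod_cast Nat.pos_of_ne_zero h)).ne'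
    rw [Finset.mul_sum, Finset.mul_sum, ← Finset.sum_sub_distrib]
    refine Finset.sum_congr rfl fun i _ => ?_
    by_cases hi : ω.1 i j = true
    · simp only [hi, if_true, message, quantError, mul_inv]
      field_simp
    · simp [hi]

lemma sum_selected_sq {n d : ℕ} (B : Fin n → Fin d → Bool) (j : Fin d) (a : ℝ) :
    ∑ i, (if B i j = true then a else 0) ^ 2 = numSelected B j * a ^ 2 := by
  simp only [ite_pow, numSelected]
  rw [Finset.sum_ite]
  simp

/-- The scaling `√ñ` makes the variance of the error independent of the number `ñ` of selected
clients. -/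
lemma measurePreserving_combineErrors {n d : ℕ} {γ σ : ℝ} (hn : 1 ≤ n) (hγ : 0 < γ)
    (B : Fin n → Fin d → Bool) (j : Fin d) :
    MeasurePreserving (combineErrors γ B j)
      ((Measure.pi fun _ : Fin n => gaussianReal 0 ((σ * γ * n) ^ 2).toNNReal).prod
        (gaussianReal 0 (σ ^ 2).toNNReal)) (gaussianReal 0 (σ ^ 2).toNNReal) := by
  by_cases h : numSelected B j = 0
  · have : combineErrors γ B j = Prod.snd := by
      ext p
      rw [combineErrors, if_pos h]
    rw [this]
    exact measurePreserving_snd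
  · have hm : (0 : ℝ) < numSelected B j := by exact_mod_cast Nat.pos_of_ne_zero h
    have hn' : (0 : ℝ) < n := by exact_mod_cast hn
    have : combineErrors γ B j = (fun z : Fin n → ℝ =>
        ∑ i, (if B i j = true then (γ * n * √(numSelected B j : ℝ))⁻¹ else 0) * z i) ∘ Prod.fst := by
      ext p
      rw [combineErrors, if_neg h]
      rfl
    rw [this]
    refine MeasurePreserving.comp ⟨by fun_prop, ?_⟩ measurePreserving_fst
    rw [gaussian_pi_map_sum, sum_selected_sq, Real.coe_toNNReal _ (by positivity), inv_pow, mul_pow,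
      Real.sq_sqrt hm.le]
    congr 2
    field_simp

lemma map_error_of_selection {n d : ℕ} {γ σ : ℝ} (hn : 1 ≤ n) (hγ : 0 < γ) (hσ : 0 < σ)
    (x : Fin n → Fin d → ℝ) (B : Fin n → Fin d → Bool) :
    MeasurePreserving (fun p : (Fin n → Fin d → ℝ × ℝ) × (Fin d → ℝ) =>
        output γ σ x (B, p) - subsampledMean γ x B)
      ((Measure.pi fun _ => Measure.pi fun _ => quantizerLaw (noisePDF n γ σ)).prod
        (gaussianVec d σ)) (gaussianVec d σ) := by
  have hv := noise_variance_ne_zero (n := n) hn hγ hσ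
  have : IsProbabilityMeasure (quantizerLaw (noisePDF n γ σ)) :=
    isProbabilityMeasure_quantizerLaw hv
  have h₁ : MeasurePreserving (fun (S : Fin n → Fin d → ℝ × ℝ) i j =>
      quantError (noisePDF n γ σ) (x i j * √(numSelected B j : ℝ)) (S i j))
      (Measure.pi fun _ => Measure.pi fun _ => quantizerLaw (noisePDF n γ σ))
      (Measure.pi fun _ => Measure.pi fun _ => gaussianReal 0 ((σ * γ * n) ^ 2).toNNReal) := by
    have h (i : Fin n) := measurePreserving_pi (fun _ : Fin d => quantizerLaw (noisePDF n γ σ)) _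
      fun j => measurePreserving_quantError hv (x i j * √(numSelected B j : ℝ))
    exact measurePreserving_pi _ _ h
  have h₂ : MeasurePreserving (fun (z : Fin n → Fin d → ℝ) j i => z i j)
      (Measure.pi fun _ => Measure.pi fun _ => gaussianReal 0 ((σ * γ * n) ^ 2).toNNReal)
      (Measure.pi fun _ => Measure.pi fun _ => gaussianReal 0 ((σ * γ * n) ^ 2).toNNReal) :=
    ⟨by fun_prop, pi_pi_map_swap _⟩
  have h₃ := (measurePreserving_arrowProdEquivProdArrow (Fin n → ℝ) ℝ (Fin d)
    (fun _ => Measure.pi fun _ => gaussianReal 0 ((σ * γ * n) ^ 2).toNNReal)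
    (fun _ => gaussianReal 0 (σ ^ 2).toNNReal)).symm
  have h₄ : MeasurePreserving (fun (p : Fin d → (Fin n → ℝ) × ℝ) j => combineErrors γ B j (p j))
      (Measure.pi fun _ =>
        (Measure.pi fun _ : Fin n => gaussianReal 0 ((σ * γ * n) ^ 2).toNNReal).prod
        (gaussianReal 0 (σ ^ 2).toNNReal)) (gaussianVec d σ) :=
    measurePreserving_pi _ _ fun j => measurePreserving_combineErrors hn hγ B j
  have h := h₄.comp (h₃.comp ((h₂.comp h₁).prod (MeasurePreserving.id (gaussianVec d σ))))
  convert h using 1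
  ext1 p
  rw [output_sub_subsampledMean γ σ x (B, p)]
  rfl

/-- The error of the output is Gaussian and independent of the selection. -/
lemma measurePreserving_error {n d : ℕ} {γ : unitInterval} {σ : ℝ} (hn : 1 ≤ n)
    (hγ : 0 < (γ : ℝ)) (hσ : 0 < σ) (x : Fin n → Fin d → ℝ) :
    MeasurePreserving (fun ω => (ω.1, output γ σ x ω - subsampledMean γ x ω.1))
      (randomnessLaw n d γ σ) ((selectionLaw n d γ).prod (gaussianVec d σ)) := by
  have hv := noise_variance_ne_zero (n := n) hn hγ hσ
  have : IsProbabilityMeasure (quantizerLaw (noisePDF n γ σ)) :=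
    isProbabilityMeasure_quantizerLaw hv
  refine (MeasurePreserving.id (selectionLaw n d γ)).skew_product
    (g := fun B p => output γ σ x (B, p) - subsampledMean γ x B) ?_
    (ae_of_all _ fun B => (map_error_of_selection hn hγ hσ x B).map_eq)
  exact measurable_from_prod_countable_right fun B =>
    (map_error_of_selection hn hγ hσ x B).measurable

/-! ### The alphabet -/

lemma descriptions_subset {v : NNReal} (hv : v ≠ 0) (r : ℝ) :
    descriptions (gaussianPDFReal 0 v) r ⊆ Set.Icc ⌈-(r / √v) - 1 / 2⌉ ⌊r / √v + 3 / 2⌋ := by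
  rintro m ⟨X, hX, u, hu, w, hw, rfl⟩
  have hv' : 0 < √(v : ℝ) := Real.sqrt_pos.2 (NNReal.coe_pos.2 (pos_iff_ne_zero.2 hv))
  have hΔ := sqrt_le_shiftedStep hv hw
  have hΔ' := hv'.trans_le hΔ
  have hr : 0 ≤ r := by linarith [hX.1, hX.2]
  have hq : |X / shiftedStep (gaussianPDFReal 0 v) w| ≤ r / √v := by
    rw [abs_div, abs_of_pos hΔ']
    exact div_le_div₀ hr (abs_le.2 hX) hv' hΔ
  rw [abs_le] at hq
  rw [encode, round_eq, Set.mem_Icc, Int.ceil_le, Int.le_floor]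
  have h₁ := Int.floor_le (X / shiftedStep (gaussianPDFReal 0 v) w + u + 1 / 2)
  have h₂ := Int.lt_floor_add_one (X / shiftedStep (gaussianPDFReal 0 v) w + u + 1 / 2)
  constructor <;> linarith [hu.1, hu.2, hq.1, hq.2]

lemma finite_descriptions {v : NNReal} (hv : v ≠ 0) (r : ℝ) :
    (descriptions (gaussianPDFReal 0 v) r).Finite :=
  (Set.finite_Icc _ _).subset (descriptions_subset hv r)

lemma ncard_descriptions_le {v : NNReal} (hv : v ≠ 0) {r : ℝ} (hr : 0 ≤ r) :
    ((descriptions (gaussianPDFReal 0 v) r).ncard : ℝ) ≤ 2 * (r / √v) + 3 := by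
  have h := Set.ncard_le_ncard (descriptions_subset hv r) (Set.finite_Icc _ _)
  have hq : 0 ≤ r / √v := by positivity
  rw [← Finset.coe_Icc, Set.ncard_coe_finset, Int.card_Icc] at h
  have h₁ := Int.floor_le (r / √v + 3 / 2)
  have h₂ := Int.le_ceil (-(r / √v) - 1 / 2)
  have h₃ : ⌈-(r / √v) - 1 / 2⌉ ≤ 0 := by
    rw [Int.ceil_le]; push_cast; linarith
  have h₄ : 0 ≤ ⌊r / √v + 3 / 2⌋ := by
    rw [Int.le_floor]; push_cast; linarith
  have h₅ : ((⌊r / √v + 3 / 2⌋ + 1 - ⌈-(r / √v) - 1 / 2⌉).toNat : ℝ) =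
      ⌊r / √v + 3 / 2⌋ + 1 - ⌈-(r / √v) - 1 / 2⌉ := by
    have := Int.toNat_of_nonneg (a := ⌊r / √v + 3 / 2⌋ + 1 - ⌈-(r / √v) - 1 / 2⌉) (by omega)
    exact_mod_cast this
  have h₆ : ((descriptions (gaussianPDFReal 0 v) r).ncard : ℝ) ≤
      ((⌊r / √v + 3 / 2⌋ + 1 - ⌈-(r / √v) - 1 / 2⌉).toNat : ℝ) := by exact_mod_cast h
  linarith

lemma ae_mem_quantizerLaw (f : ℝ → ℝ) :
    ∀ᵐ s ∂quantizerLaw f, s.1 ∈ Set.Ioo (0 : ℝ) 1 ∧ s.2 ∈ Set.Ioo 0 (peak f) := by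
  have h₁ : ∀ᵐ u ∂(volume.restrict (Set.Ioo (0 : ℝ) 1)), u ∈ Set.Ioo (0 : ℝ) 1 :=
    ae_restrict_mem measurableSet_Ioo
  have h₂ : ∀ᵐ w ∂(volume.withDensity fun x => ENNReal.ofReal (shiftedStep f x)),
      w ∈ Set.Ioo 0 (peak f) := by
    rw [ae_iff]
    change (volume.withDensity _) (Set.Ioo 0 (peak f))ᶜ = 0
    rw [withDensity_apply _ measurableSet_Ioo.compl,
      setLIntegral_congr_fun measurableSet_Ioo.compl (g := fun _ => 0) fun w hw => ?_]
    · simp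
    · simp only [shiftedStep, Set.indicator_of_notMem hw, ENNReal.ofReal_zero]
  exact (Measure.quasiMeasurePreserving_fst.ae h₁).and (Measure.quasiMeasurePreserving_snd.ae h₂)

lemma ae_message_mem_alphabet {n d : ℕ} {γ : unitInterval} {c σ : ℝ} (hn : 1 ≤ n)
    (hγ : 0 < (γ : ℝ)) (hσ : 0 < σ) (x : BoxData n d c) :
    ∀ᵐ ω ∂(randomnessLaw n d γ σ), ∀ i j, ω.1 i j = true →
      message γ σ x.1 ω.1 ω.2.1 i j ∈ alphabet (γ : ℝ) σ c ω.1 j := by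
  have hv := noise_variance_ne_zero (n := n) hn hγ hσ
  have : IsProbabilityMeasure (quantizerLaw (noisePDF n γ σ)) :=
    isProbabilityMeasure_quantizerLaw hv
  rw [ae_all_iff]
  intro i
  rw [ae_all_iff]
  intro j
  have h := (((Measure.quasiMeasurePreserving_eval _ j).comp
    (Measure.quasiMeasurePreserving_eval _ i)).comp
    (Measure.quasiMeasurePreserving_fst.comp Measure.quasiMeasurePreserving_snd :
      Measure.QuasiMeasurePreserving (fun ω : Randomness n d => ω.2.1)
        (randomnessLaw n d γ σ) _)).ae (ae_mem_quantizerLaw (noisePDF n γ σ))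
  filter_upwards [h] with ω hω hB
  rw [message, if_pos hB, alphabet]
  have hx := x.2 i j
  have hs := Real.sqrt_nonneg (numSelected ω.1 j : ℝ)
  exact ⟨_, ⟨by nlinarith [hx.1], by nlinarith [hx.2]⟩, _, hω.1, _, hω.2, rfl⟩

/-! ### The mean squared error -/

lemma integral_selectionLaw_ite {n d : ℕ} (γ : unitInterval) (i : Fin n) (j : Fin d) (a : ℝ) :
    ∫ B, (if B i j = true then a else 0) ∂(selectionLaw n d γ) = γ * a := by
  have h := ((measurePreserving_eval (fun _ : Fin d => bernoulliMeasure true false γ) j).comp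
    (measurePreserving_eval (fun _ : Fin n =>
      Measure.pi fun _ : Fin d => bernoulliMeasure true false γ) i))
  have h' := h.map_eq ▸ integral_map (μ := selectionLaw n d γ) h.measurable.aemeasurable
    (f := fun b : Bool => if b = true then a else 0) (by fun_prop)
  refine h'.symm.trans ?_
  rw [integral_bernoulliMeasure]
  simp

lemma integral_subsampledMean {n d : ℕ} {γ : unitInterval} (hγ : 0 < (γ : ℝ))
    (x : Fin n → Fin d → ℝ) (j : Fin d) :
    ∫ B, subsampledMean γ x B j ∂(selectionLaw n d γ) = (n : ℝ)⁻¹ * ∑ i, x i j := by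
  simp only [subsampledMean]
  rw [integral_const_mul, integral_finsetSum _ fun i _ => .of_finite]
  simp_rw [integral_selectionLaw_ite]
  rw [← Finset.mul_sum, mul_inv]
  field_simp

lemma integral_sq_subsampledMean_sub_le {n d : ℕ} {γ : unitInterval} {c : ℝ} (hn : 1 ≤ n)
    (hγ : 0 < (γ : ℝ)) (x : BoxData n d c) (j : Fin d) :
    ∫ B, (subsampledMean γ x.1 B j - (n : ℝ)⁻¹ * ∑ i, x.1 i j) ^ 2 ∂(selectionLaw n d γ) ≤
      c ^ 2 / (n * γ) := by
  have hn' : (0 : ℝ) < n := by exact_mod_cast hn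
  let X : Fin n → (Fin d → Bool) → ℝ := fun i b => (γ * n : ℝ)⁻¹ * if b j = true then x.1 i j else 0
  have hX : (fun B => subsampledMean γ x.1 B j) = ∑ i, fun B : Fin n → Fin d → Bool => X i (B i) := by
    ext B
    rw [Finset.sum_apply, subsampledMean, Finset.mul_sum]
  have h := variance_sum_pi (μ := fun _ : Fin n =>
    Measure.pi fun _ : Fin d => bernoulliMeasure true false γ) (X := X) fun i => .of_discrete
  rw [← integral_subsampledMean hγ, ← variance_eq_integral (by fun_prop), hX]
  refine (h.trans_le (Finset.sum_le_sum (g := fun _ => c ^ 2 / (γ * n ^ 2)) fun i _ => ?_)).trans_eq ?_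
  · refine (variance_le_expectation_sq (by fun_prop)).trans ?_
    have h₂ := integral_comp_eval (μ := fun _ : Fin d => bernoulliMeasure true false γ) (i := j)
      (f := fun b : Bool => ((γ * n : ℝ)⁻¹ * if b = true then x.1 i j else 0) ^ 2) (by fun_prop)
    refine h₂.trans_le ?_
    rw [integral_bernoulliMeasure]
    simp only [if_true, smul_eq_mul, Bool.false_eq_true, if_false, mul_zero, ne_eq, OfNat.ofNat_ne_zero,
      not_false_eq_true, zero_pow, add_zero]
    have hxc : (x.1 i j) ^ 2 ≤ c ^ 2 := sq_le_sq' (x.2 i j).1 (x.2 i j).2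
    calc _ = (x.1 i j) ^ 2 / (γ * n ^ 2) := by field_simp
      _ ≤ _ := by gcongr
  · rw [Finset.sum_const, Finset.card_univ, Fintype.card_fin, nsmul_eq_mul]
    field_simp

lemma integrable_sqError_and_integral_le {n d : ℕ} {γ : unitInterval} {c σ : ℝ} (hn : 1 ≤ n)
    (hγ : 0 < (γ : ℝ)) (hσ : 0 < σ) (x : BoxData n d c) :
    Integrable (sqError γ σ x.1) (randomnessLaw n d γ σ) ∧
      ∫ ω, sqError γ σ x.1 ω ∂(randomnessLaw n d γ σ) ≤ d * c ^ 2 / (n * γ) + d * σ ^ 2 := by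
  have hmp := measurePreserving_error hn hγ hσ x.1
  let t : Fin d → (Fin n → Fin d → Bool) → ℝ := fun j B =>
    subsampledMean γ x.1 B j - (n : ℝ)⁻¹ * ∑ i, x.1 i j
  let F : (Fin n → Fin d → Bool) × (Fin d → ℝ) → ℝ := fun p =>
    ∑ j, ((p.2 j) ^ 2 + 2 * (t j p.1 * p.2 j) + (t j p.1) ^ 2)
  have hF : sqError γ σ x.1 = F ∘ fun ω => (ω.1, output γ σ x.1 ω - subsampledMean γ x.1 ω.1) := by
    ext ω
    simp only [sqError, Function.comp_apply, F, t, Pi.sub_apply]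
    refine Finset.sum_congr rfl fun j _ => ?_
    ring
  have ht : ∀ j, Measurable (t j) := fun j => .of_discrete
  have hL : ∀ j, MemLp (fun e : Fin d → ℝ => e j) 2 (gaussianVec d σ) := fun j =>
    (memLp_id_gaussianReal 2).comp_measurePreserving
      (measurePreserving_eval (fun _ : Fin d => gaussianReal 0 (σ ^ 2).toNNReal) j)
  have i₁ : ∀ j, Integrable (fun p : (Fin n → Fin d → Bool) × (Fin d → ℝ) => (p.2 j) ^ 2)
      ((selectionLaw n d γ).prod (gaussianVec d σ)) := fun j =>
    (hL j).integrable_sq.comp_snd _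
  have i₂ : ∀ j, Integrable (fun p : (Fin n → Fin d → Bool) × (Fin d → ℝ) => t j p.1 * p.2 j)
      ((selectionLaw n d γ).prod (gaussianVec d σ)) := fun j =>
    Integrable.mul_prod (.of_finite : Integrable (t j) _) ((hL j).integrable one_le_two)
  have i₃ : ∀ j, Integrable (fun p : (Fin n → Fin d → Bool) × (Fin d → ℝ) => (t j p.1) ^ 2)
      ((selectionLaw n d γ).prod (gaussianVec d σ)) := fun j =>
    (.of_finite : Integrable (fun B => (t j B) ^ 2) (selectionLaw n d γ)).comp_fst _
  have hFm : AEStronglyMeasurable F ((selectionLaw n d γ).prod (gaussianVec d σ)) := by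
    refine Measurable.aestronglyMeasurable ?_
    have : ∀ j, Measurable (fun p : (Fin n → Fin d → Bool) × (Fin d → ℝ) => t j p.1) := fun j =>
      (ht j).comp measurable_fst
    fun_prop
  rw [hF]
  have hFi : Integrable F ((selectionLaw n d γ).prod (gaussianVec d σ)) :=
    integrable_finsetSum _ fun j _ => ((i₁ j).add ((i₂ j).const_mul 2)).add (i₃ j)
  refine ⟨(hmp.integrable_comp hFm).2 hFi, ?_⟩
  have e₁ : ∫ ω, (F ∘ fun ω => (ω.1, output γ σ x.1 ω - subsampledMean γ x.1 ω.1)) ω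
      ∂(randomnessLaw n d γ σ) = ∫ p, F p ∂((selectionLaw n d γ).prod (gaussianVec d σ)) := by
    rw [← hmp.map_eq, integral_map hmp.measurable.aemeasurable (hmp.map_eq ▸ hFm)]
    rfl
  have e₂ : ∫ p, F p ∂((selectionLaw n d γ).prod (gaussianVec d σ)) =
      ∑ j, ∫ p, ((p.2 j) ^ 2 + 2 * (t j p.1 * p.2 j) + (t j p.1) ^ 2)
        ∂((selectionLaw n d γ).prod (gaussianVec d σ)) :=
    integral_finsetSum _ fun j _ => ((i₁ j).add ((i₂ j).const_mul 2)).add (i₃ j)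
  rw [e₁, e₂]
  refine (Finset.sum_le_sum (g := fun _ => σ ^ 2 + c ^ 2 / (n * γ)) fun j _ => ?_).trans_eq ?_
  · rw [integral_add (f := fun p => (p.2 j) ^ 2 + 2 * (t j p.1 * p.2 j))
        ((i₁ j).add ((i₂ j).const_mul 2)) (i₃ j),
      integral_add (i₁ j) ((i₂ j).const_mul 2), integral_const_mul,
      integral_prod_mul (t j) (fun e : Fin d → ℝ => e j),
      integral_fun_fst (fun B => (t j B) ^ 2), integral_fun_snd (fun e : Fin d → ℝ => (e j) ^ 2)]
    have z₁ : ∫ e, e j ∂(gaussianVec d σ) = 0 := by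
      have := integral_comp_eval (μ := fun _ : Fin d => gaussianReal 0 (σ ^ 2).toNNReal) (i := j)
        (f := fun y : ℝ => y) (by fun_prop)
      exact this.trans integral_id_gaussianReal
    have z₂ : ∫ e, (e j) ^ 2 ∂(gaussianVec d σ) = σ ^ 2 := by
      have := integral_comp_eval (μ := fun _ : Fin d => gaussianReal 0 (σ ^ 2).toNNReal) (i := j)
        (f := fun y : ℝ => y ^ 2) (by fun_prop)
      refine this.trans ?_
      have hv := variance_fun_id_gaussianReal (μ := 0) (v := (σ ^ 2).toNNReal)
      rw [variance_eq_integral (by fun_prop), integral_id_gaussianReal,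
        Real.coe_toNNReal _ (by positivity)] at hv
      simpa using hv
    rw [z₁, z₂]
    simp only [probReal_univ, one_smul, mul_zero, add_zero]
    exact add_le_add le_rfl (integral_sq_subsampledMean_sub_le hn hγ x j)
  · rw [Finset.sum_const, Finset.card_univ, Fintype.card_fin, nsmul_eq_mul]
    ring

/-! ### The communication cost -/

lemma integral_selectionLaw_numSelected_le {n d : ℕ} (γ : unitInterval) (i : Fin n) (j : Fin d) :
    ∫ B, (if B i j = true then (numSelected B j : ℝ) else 0) ∂(selectionLaw n d γ) ≤
      γ * (1 + n * γ) := by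
  have hβ : ∀ B : Fin n → Fin d → Bool, (if B i j = true then (numSelected B j : ℝ) else 0) =
      ∑ k, (if B i j = true then (1 : ℝ) else 0) * (if B k j = true then 1 else 0) := fun B => by
    rw [← Finset.mul_sum, Finset.sum_boole]
    simp [numSelected]
  simp_rw [hβ]
  rw [integral_finsetSum _ fun k _ => .of_finite]
  have hk : ∀ k, ∫ B, (if B i j = true then (1 : ℝ) else 0) * (if B k j = true then 1 else 0)
      ∂(selectionLaw n d γ) ≤ (if k = i then (γ : ℝ) else 0) + γ * γ := by
    intro k
    by_cases hki : k = i
    · subst hki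
      have : ∀ B : Fin n → Fin d → Bool, (if B k j = true then (1 : ℝ) else 0) *
          (if B k j = true then 1 else 0) = if B k j = true then 1 else 0 := fun B => by
        split_ifs <;> simp
      simp_rw [this]
      rw [integral_selectionLaw_ite]
      simp only [if_true]
      nlinarith [γ.2.1]
    · have hind := (iIndepFun_pi (μ := fun _ : Fin n =>
          Measure.pi fun _ : Fin d => bernoulliMeasure true false γ)
          (X := fun _ b => if b j = true then (1 : ℝ) else 0) fun _ => by fun_prop).indepFun
          (Ne.symm hki)
      have := hind.integral_fun_mul_eq_mul_integral (by fun_prop) (by fun_prop)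
      refine this.trans_le ?_
      have h₁ := integral_selectionLaw_ite γ i j 1
      have h₂ := integral_selectionLaw_ite γ k j 1
      rw [selectionLaw] at h₁ h₂
      rw [h₁, h₂, if_neg hki]
      simp
  refine (Finset.sum_le_sum fun k _ => hk k).trans_eq ?_
  rw [Finset.sum_add_distrib, Finset.sum_ite_eq' Finset.univ i, Finset.sum_const, Finset.card_univ,
    Fintype.card_fin, nsmul_eq_mul, if_pos (Finset.mem_univ i)]
  ring

/-- The square makes the bound a logarithm of an affine function of `q ^ 2`, hence concave in the
number of selected clients. -/
lemma clog_two_le {N : ℕ} {q : ℝ} (hq : 0 ≤ q) (hN : (N : ℝ) ≤ 2 * q + 3) :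
    (Nat.clog 2 N : ℝ) ≤ Real.logb 2 (72 + 32 * q ^ 2) / 2 := by
  have h0 : 0 ≤ Real.logb 2 (72 + 32 * q ^ 2) / 2 :=
    div_nonneg (Real.logb_nonneg one_lt_two (by nlinarith [sq_nonneg q])) two_pos.le
  rcases Nat.eq_zero_or_pos N with rfl | hpos
  · simpa using h0
  have hN1 : (1 : ℝ) ≤ N := by exact_mod_cast hpos
  have h₁ : (Nat.clog 2 N : ℝ) ≤ Real.logb 2 N + 1 := by
    have := Real.natCeil_logb_natCast 2 N
    rw [Nat.cast_ofNat] at this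
    rw [← this]
    exact (Nat.ceil_lt_add_one (Real.logb_nonneg one_lt_two hN1)).le
  have h₂ : Real.logb 2 N + 1 = Real.logb 2 ((2 * N) ^ 2) / 2 := by
    rw [Real.logb_pow, Real.logb_mul two_ne_zero (by positivity), Real.logb_self_eq_one one_lt_two]
    push_cast
    ring
  rw [h₂] at h₁
  refine h₁.trans ?_
  have : (2 * (N : ℝ)) ^ 2 ≤ 72 + 32 * q ^ 2 := by nlinarith [sq_nonneg (2 * q - 3)]
  have := Real.logb_le_logb_of_le one_lt_two (by positivity) this
  linarith

/-- The concavity of the logarithm bounds the expected number of bits by the number of bits for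
`1 + n γ` selected clients. -/
lemma integral_clientBits_le {n d : ℕ} {γ : unitInterval} {c σ : ℝ} (hn : 1 ≤ n)
    (hγ : 0 < (γ : ℝ)) (hc : 0 < c) (hσ : 0 < σ) (ha : c / (σ * γ * n) ≤ 1) (i : Fin n) :
    ∫ B, (clientBits (γ : ℝ) σ c i B : ℝ) ∂(selectionLaw n d γ) ≤
      4 * (γ * d * Real.logb 2 (2 + c / (σ * √(n * γ)))) := by
  have hn' : (0 : ℝ) < n := by exact_mod_cast hn
  have hv := noise_variance_ne_zero (n := n) hn hγ hσ
  set a := c / (σ * γ * n) with ha_def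
  have ha0 : 0 < a := by positivity
  set y := 72 + 32 * (a ^ 2 * (1 + n * γ)) with hy
  have hy0 : 0 < y := by positivity
  have hlog2 : 0 < Real.log 2 := Real.log_pos one_lt_two
  have hbits : ∀ (B : Fin n → Fin d → Bool) (j : Fin d),
      ((if B i j = true then Nat.clog 2 (alphabet (γ : ℝ) σ c B j).ncard else 0 : ℕ) : ℝ) ≤
        (if B i j = true then Real.log y / (2 * Real.log 2) + (72 - y) / (2 * Real.log 2 * y) else 0) +
          32 * a ^ 2 / (2 * Real.log 2 * y) * (if B i j = true then (numSelected B j : ℝ) else 0) := by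
    intro B j
    by_cases hB : B i j = true
    · simp only [hB, if_true]
      have hr : 0 ≤ c * √(numSelected B j : ℝ) := by positivity
      have hcard := ncard_descriptions_le hv hr
      have hsq : √((((σ * γ * n) ^ 2).toNNReal : NNReal) : ℝ) = σ * γ * n := by
        rw [Real.coe_toNNReal _ (by positivity), Real.sqrt_sq (by positivity)]
      rw [hsq] at hcard
      refine (clog_two_le (by positivity) hcard).trans ?_
      have hq : (c * √(numSelected B j : ℝ) / (σ * γ * n)) ^ 2 = a ^ 2 * numSelected B j := by
        rw [ha_def, div_pow, mul_pow, Real.sq_sqrt (Nat.cast_nonneg _)]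
        ring
      rw [hq, Real.logb]
      have hz : 0 < 72 + 32 * (a ^ 2 * numSelected B j) := by positivity
      -- the tangent of the logarithm at `y`
      have htan := Real.log_le_sub_one_of_pos (div_pos hz hy0)
      rw [Real.log_div hz.ne' hy0.ne'] at htan
      have : Real.log (72 + 32 * (a ^ 2 * numSelected B j)) ≤
          Real.log y + (72 + 32 * (a ^ 2 * numSelected B j) - y) / y := by
        rw [sub_div, div_self hy0.ne']
        linarith
      calc _ = Real.log (72 + 32 * (a ^ 2 * numSelected B j)) / (2 * Real.log 2) := by
            rw [div_div, mul_comm (Real.log 2)]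
        _ ≤ (Real.log y + (72 + 32 * (a ^ 2 * numSelected B j) - y) / y) / (2 * Real.log 2) := by
            gcongr
        _ = _ := by
            field_simp
            ring
    · simp [hB]
  have hj : ∀ j : Fin d, ∫ B, ((if B i j = true then Nat.clog 2 (alphabet (γ : ℝ) σ c B j).ncard
      else 0 : ℕ) : ℝ) ∂(selectionLaw n d γ) ≤ γ * (Real.log y / (2 * Real.log 2)) := by
    intro j
    refine (integral_mono .of_finite .of_finite fun B => hbits B j).trans ?_
    rw [integral_add .of_finite .of_finite, integral_const_mul, integral_selectionLaw_ite]
    have := mul_le_mul_of_nonneg_left (integral_selectionLaw_numSelected_le γ i j)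
      (show 0 ≤ 32 * a ^ 2 / (2 * Real.log 2 * y) by positivity)
    refine (add_le_add le_rfl this).trans_eq ?_
    have : γ * ((72 - y) / (2 * Real.log 2 * y)) +
        32 * a ^ 2 / (2 * Real.log 2 * y) * (γ * (1 + n * γ)) = (0 : ℝ) := by
      field_simp
      rw [hy]
      ring
    linarith
  have hsum : ∫ B, (clientBits (γ : ℝ) σ c i B : ℝ) ∂(selectionLaw n d γ) ≤
      d * (γ * (Real.log y / (2 * Real.log 2))) := by
    simp only [clientBits, Nat.cast_sum]
    rw [integral_finsetSum _ fun j _ => .of_finite]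
    refine (Finset.sum_le_sum fun j _ => hj j).trans_eq ?_
    rw [Finset.sum_const, Finset.card_univ, Fintype.card_fin, nsmul_eq_mul]
  refine hsum.trans ?_
  set p := c / (σ * √(n * γ)) with hp
  have hp0 : 0 < p := by positivity
  have hp2 : p ^ 2 = a ^ 2 * (n * γ) := by
    rw [hp, ha_def, div_pow, mul_pow, Real.sq_sqrt (by positivity)]
    field_simp
  have hyp : y ≤ (2 + p) ^ 8 := by
    have h₁ : y ≤ 104 + 32 * p ^ 2 := by
      rw [hp2, hy]
      nlinarith
    have h₂ : (4 : ℝ) ≤ (2 + p) ^ 2 := by nlinarith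
    have h₃ : (64 : ℝ) ≤ (2 + p) ^ 6 := by
      calc (64 : ℝ) = 4 ^ 3 := by norm_num
        _ ≤ ((2 + p) ^ 2) ^ 3 := by gcongr
        _ = _ := by ring
    calc y ≤ 64 * (2 + p) ^ 2 := by nlinarith
      _ ≤ (2 + p) ^ 6 * (2 + p) ^ 2 := by gcongr
      _ = _ := by ring
  have hl : Real.log y ≤ 8 * Real.log (2 + p) := by
    have := Real.log_le_log hy0 hyp
    rwa [Real.log_pow] at this
  calc (d : ℝ) * (γ * (Real.log y / (2 * Real.log 2)))
      ≤ d * (γ * (8 * Real.log (2 + p) / (2 * Real.log 2))) := by gcongr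
    _ = _ := by
      rw [Real.logb]
      field_simp
      ring

/-! ### Privacy loss of one coordinate -/

/-- The density of `N(a, 1)` with respect to `N(0, 1)`. -/
noncomputable def gaussianRatio (a z : ℝ) : ℝ := Real.exp (a * z - a ^ 2 / 2)

/-- The density of the mixture `(1 - γ) N(0, 1) + γ N(a, 1)` with respect to `N(0, 1)`. -/
noncomputable def mixRatio (γ a z : ℝ) : ℝ := 1 - γ + γ * gaussianRatio a z

lemma measurable_mixRatio (γ a : ℝ) : Measurable (mixRatio γ a) := by
  unfold mixRatio gaussianRatio
  fun_prop

section Pointwise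

variable {γ h a b : ℝ}

lemma mul_le_mul_abs (ha : |a| ≤ h) (z : ℝ) : |a * z| ≤ h * |z| := by
  rw [abs_mul]
  gcongr

lemma exp_neg_le_gaussianRatio (h1 : h ≤ 1) (ha : |a| ≤ h) (z : ℝ) :
    Real.exp (-(h * |z| + 1)) ≤ gaussianRatio a z := by
  refine Real.exp_le_exp.2 ?_
  have h₁ := (abs_le.1 (mul_le_mul_abs ha z)).1
  have h₂ : a ^ 2 ≤ 1 := by
    rw [← sq_abs]
    nlinarith [abs_nonneg a]
  linarith

lemma gaussianRatio_le_exp (ha : |a| ≤ h) (z : ℝ) : gaussianRatio a z ≤ Real.exp (h * |z|) := by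
  refine Real.exp_le_exp.2 ?_
  have h₁ := (abs_le.1 (mul_le_mul_abs ha z)).2
  nlinarith [sq_nonneg a]

lemma abs_exp_sub_exp_le {u v m : ℝ} (hu : u ≤ m) (hv : v ≤ m) :
    |Real.exp u - Real.exp v| ≤ |u - v| * Real.exp m := by
  wlog huv : v ≤ u generalizing u v
  · rw [abs_sub_comm, abs_sub_comm u]
    exact this hv hu (le_of_not_ge huv)
  rw [abs_of_nonneg (sub_nonneg.2 (Real.exp_le_exp.2 huv)), abs_of_nonneg (sub_nonneg.2 huv)]
  have h₁ : Real.exp u - Real.exp v ≤ (u - v) * Real.exp u := by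
    have := Real.add_one_le_exp (v - u)
    have h₂ : Real.exp v = Real.exp u * Real.exp (v - u) := by
      rw [← Real.exp_add]
      congr 1
      ring
    rw [h₂]
    nlinarith [Real.exp_pos u]
  refine h₁.trans ?_
  have := sub_nonneg.2 huv
  gcongr

lemma abs_gaussianRatio_sub_le (h0 : 0 ≤ h) (h1 : h ≤ 1) (ha : |a| ≤ h) (hb : |b| ≤ h) (z : ℝ) :
    |gaussianRatio a z - gaussianRatio b z| ≤ 2 * h * (1 + |z|) * Real.exp (h * |z|) := by
  have ha' := mul_le_mul_abs ha z
  have hb' := mul_le_mul_abs hb z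
  have ha₂ : a ^ 2 ≤ h ^ 2 := by
    rw [← sq_abs]
    gcongr
  have hb₂ : b ^ 2 ≤ h ^ 2 := by
    rw [← sq_abs]
    gcongr
  rw [abs_le] at ha' hb'
  refine (abs_exp_sub_exp_le (m := h * |z|) (by nlinarith) (by nlinarith)).trans ?_
  gcongr
  rw [abs_le]
  constructor <;> nlinarith [sq_nonneg a, sq_nonneg b]

lemma exp_neg_le_mixRatio (γ0 : 0 ≤ γ) (γ1 : γ ≤ 1) (h0 : 0 ≤ h) (h1 : h ≤ 1) (ha : |a| ≤ h)
    (z : ℝ) : Real.exp (-(h * |z| + 1)) ≤ mixRatio γ a z := by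
  have h₁ := exp_neg_le_gaussianRatio h1 ha z
  have h₂ : Real.exp (-(h * |z| + 1)) ≤ 1 :=
    Real.exp_le_one_iff.2 (neg_nonpos.2 (by positivity))
  rw [mixRatio]
  nlinarith

lemma mixRatio_pos (γ0 : 0 ≤ γ) (γ1 : γ ≤ 1) (a z : ℝ) : 0 < mixRatio γ a z := by
  have : 0 < gaussianRatio a z := Real.exp_pos _
  rw [mixRatio]
  rcases γ1.lt_or_eq with h | rfl
  · have := sub_pos.2 h
    positivity
  · simpa using this

lemma inv_mixRatio_le (γ0 : 0 ≤ γ) (γ1 : γ ≤ 1) (h0 : 0 ≤ h) (h1 : h ≤ 1) (ha : |a| ≤ h)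
    (z : ℝ) : (mixRatio γ a z)⁻¹ ≤ Real.exp (h * |z| + 1) := by
  have := inv_anti₀ (Real.exp_pos _) (exp_neg_le_mixRatio γ0 γ1 h0 h1 ha z)
  rwa [Real.exp_neg, inv_inv] at this

lemma mixRatio_le_exp (γ0 : 0 ≤ γ) (γ1 : γ ≤ 1) (h0 : 0 ≤ h) (ha : |a| ≤ h) (z : ℝ) :
    mixRatio γ a z ≤ Real.exp (h * |z|) := by
  have h₁ := gaussianRatio_le_exp ha z
  have h₂ : 1 ≤ Real.exp (h * |z|) := Real.one_le_exp (by positivity)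
  rw [mixRatio]
  nlinarith

lemma abs_mixRatio_sub_le (γ0 : 0 ≤ γ) (h0 : 0 ≤ h) (h1 : h ≤ 1) (ha : |a| ≤ h) (hb : |b| ≤ h)
    (z : ℝ) :
    |mixRatio γ a z - mixRatio γ b z| ≤ 2 * (γ * h) * (1 + |z|) * Real.exp (h * |z|) := by
  have : mixRatio γ a z - mixRatio γ b z = γ * (gaussianRatio a z - gaussianRatio b z) := by
    rw [mixRatio, mixRatio]
    ring
  rw [this, abs_mul, abs_of_nonneg γ0]
  have := mul_le_mul_of_nonneg_left (abs_gaussianRatio_sub_le h0 h1 ha hb z) γ0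
  linarith

lemma log_mixRatio_div_le (γ0 : 0 ≤ γ) (γ1 : γ ≤ 1) (h0 : 0 ≤ h) (h1 : h ≤ 1) (ha : |a| ≤ h)
    (hb : |b| ≤ h) (z : ℝ) :
    Real.log (mixRatio γ a z / mixRatio γ b z) ≤
      2 * (γ * h) * (1 + |z|) * Real.exp (2 * h * |z| + 1) := by
  have hq := mixRatio_pos γ0 γ1 b z
  have hp := mixRatio_pos γ0 γ1 a z
  refine (Real.log_le_sub_one_of_pos (div_pos hp hq)).trans ?_
  have h₁ : mixRatio γ a z / mixRatio γ b z - 1 =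
      (mixRatio γ a z - mixRatio γ b z) * (mixRatio γ b z)⁻¹ := by
    field_simp
  have h₂ : Real.exp (2 * h * |z| + 1) = Real.exp (h * |z|) * Real.exp (h * |z| + 1) := by
    rw [← Real.exp_add]
    congr 1
    ring
  rw [h₁, h₂, ← mul_assoc]
  exact mul_le_mul ((le_abs_self _).trans (abs_mixRatio_sub_le γ0 h0 h1 ha hb z))
    (inv_mixRatio_le γ0 γ1 h0 h1 hb z) (inv_nonneg.2 hq.le) (by positivity)

end Pointwise

lemma exp_le_one_add_add_sq_mul {x y : ℝ} (hy : 0 ≤ y) (hxy : x ≤ y) :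
    Real.exp x ≤ 1 + x + x ^ 2 * Real.exp y := by
  rcases le_total 0 x with hx | hx
  · have h₁ : Real.exp x * (1 - x) ≤ 1 := by
      have := Real.add_one_le_exp (-x)
      calc _ ≤ Real.exp x * Real.exp (-x) := by gcongr; linarith
        _ = 1 := by rw [← Real.exp_add, add_neg_cancel, Real.exp_zero]
    have h₂ : Real.exp x ≤ Real.exp y := Real.exp_le_exp.2 hxy
    have h₃ : x * (Real.exp x - 1) ≤ x * (x * Real.exp x) :=
      mul_le_mul_of_nonneg_left (by linarith) hx
    have h₄ : x ^ 2 * Real.exp x ≤ x ^ 2 * Real.exp y := by gcongr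
    nlinarith
  · have h₁ : Real.exp x * (1 - x) ≤ 1 := by
      have := Real.add_one_le_exp (-x)
      calc _ ≤ Real.exp x * Real.exp (-x) := by gcongr; linarith
        _ = 1 := by rw [← Real.exp_add, add_neg_cancel, Real.exp_zero]
    have h₂ : 1 ≤ Real.exp y := Real.one_le_exp hy
    have h₃ : Real.exp x ≤ 1 + x + x ^ 2 := by
      by_contra hcon
      push Not at hcon
      have : (1 + x + x ^ 2) * (1 - x) < Real.exp x * (1 - x) :=
        mul_lt_mul_of_pos_right hcon (by linarith)
      nlinarith [pow_nonneg (neg_nonneg.2 hx) 3]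
    nlinarith [sq_nonneg x]

/-- A second-order bound for the clipped privacy loss of densities `p` and `q` at a point. -/
lemma exp_clipped_log_mul_le {p q t y : ℝ} (hp : 0 < p) (hq : 0 < q) (ht : 0 ≤ t) (hy : 0 ≤ y) :
    Real.exp (min (t * Real.log (p / q)) y) * p ≤
      p + t * (p - q) + t * ((p - q) ^ 2 * q⁻¹) +
        t ^ 2 * ((p - q) ^ 2 * (p⁻¹ + p * q⁻¹ ^ 2) * Real.exp y) := by
  set x := min (t * Real.log (p / q)) y with hx
  set l := Real.log (p / q) with hl
  have h₁ : x ≤ t * (p / q - 1) :=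
    (min_le_left _ _).trans (mul_le_mul_of_nonneg_left (Real.log_le_sub_one_of_pos (by positivity)) ht)
  have h₂ : l ^ 2 ≤ (p / q - 1) ^ 2 + (q / p - 1) ^ 2 := by
    have u : l ≤ p / q - 1 := Real.log_le_sub_one_of_pos (by positivity)
    have v : -l ≤ q / p - 1 := by
      rw [hl, ← Real.log_inv, inv_div]
      exact Real.log_le_sub_one_of_pos (by positivity)
    rcases le_total 0 l with h | h
    · nlinarith [sq_nonneg (q / p - 1)]
    · nlinarith [sq_nonneg (p / q - 1)]
  have h₃ : x ^ 2 ≤ t ^ 2 * l ^ 2 := by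
    rw [← mul_pow, hx]
    rcases le_total (t * l) y with h | h
    · rw [min_eq_left h]
    · rw [min_eq_right h]
      gcongr
  have h₄ := exp_le_one_add_add_sq_mul hy (min_le_right (t * l) y)
  rw [← hx] at h₄
  calc Real.exp x * p ≤ (1 + t * (p / q - 1) +
        t ^ 2 * ((p / q - 1) ^ 2 + (q / p - 1) ^ 2) * Real.exp y) * p := by
        gcongr
        refine h₄.trans ?_
        gcongr
        exact h₃.trans (by gcongr)
    _ = _ := by
        field_simp
        ring

lemma one_add_abs_le_exp (z : ℝ) : 1 + |z| ≤ Real.exp |z| := by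
  linarith [Real.add_one_le_exp |z|]

/-- The constants are crude: every factor is bounded by a power of `exp |z|`. -/
lemma exp_clipped_loss_mul_le {γ h a b t : ℝ} (γ0 : 0 ≤ γ) (γ1 : γ ≤ 1) (h0 : 0 ≤ h) (h1 : h ≤ 1)
    (ha : |a| ≤ h) (hb : |b| ≤ h) (ht : 0 ≤ t) (z : ℝ) :
    Real.exp (min (t * Real.log (mixRatio γ a z / mixRatio γ b z)) (1 + |z|)) * mixRatio γ a z ≤
      mixRatio γ a z + t * (mixRatio γ a z - mixRatio γ b z) +
        (t + t ^ 2) * (8 * (γ * h) ^ 2 * Real.exp 3) * Real.exp (8 * |z|) := by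
  have hp := mixRatio_pos γ0 γ1 a z
  have hq := mixRatio_pos γ0 γ1 b z
  refine (exp_clipped_log_mul_le hp hq ht (by positivity)).trans ?_
  set w := Real.exp |z| with hw
  have hw1 : 1 ≤ w := Real.one_le_exp (abs_nonneg z)
  have hhz : h * |z| ≤ |z| := mul_le_of_le_one_left (abs_nonneg z) h1
  have hmono : Real.exp (h * |z|) ≤ w := Real.exp_le_exp.2 hhz
  have hE : 1 ≤ Real.exp 1 := Real.one_le_exp zero_le_one
  have hpi : (mixRatio γ a z)⁻¹ ≤ Real.exp 1 * w := by
    refine (inv_mixRatio_le γ0 γ1 h0 h1 ha z).trans ?_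
    rw [hw, ← Real.exp_add]
    exact Real.exp_le_exp.2 (by linarith)
  have hqi : (mixRatio γ b z)⁻¹ ≤ Real.exp 1 * w := by
    refine (inv_mixRatio_le γ0 γ1 h0 h1 hb z).trans ?_
    rw [hw, ← Real.exp_add]
    exact Real.exp_le_exp.2 (by linarith)
  have hpw : mixRatio γ a z ≤ w := (mixRatio_le_exp γ0 γ1 h0 ha z).trans hmono
  have hsq : (mixRatio γ a z - mixRatio γ b z) ^ 2 ≤ 4 * (γ * h) ^ 2 * w ^ 4 := by
    have h₁ : |mixRatio γ a z - mixRatio γ b z| ≤ 2 * (γ * h) * w * w :=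
      (abs_mixRatio_sub_le γ0 h0 h1 ha hb z).trans
        (mul_le_mul (mul_le_mul_of_nonneg_left (one_add_abs_le_exp z) (by positivity)) hmono
          (Real.exp_pos _).le (by positivity))
    rw [← sq_abs]
    calc _ ≤ (2 * (γ * h) * w * w) ^ 2 := by gcongr
      _ = _ := by ring
  have e3 : Real.exp 3 = Real.exp 1 ^ 3 := by rw [← Real.exp_nat_mul]; norm_num
  have e8 : Real.exp (8 * |z|) = w ^ 8 := by rw [hw, ← Real.exp_nat_mul]; norm_num
  have ey : Real.exp (1 + |z|) = Real.exp 1 * w := Real.exp_add _ _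
  rw [e3, e8, ey]
  have hqi0 : 0 ≤ (mixRatio γ b z)⁻¹ := inv_nonneg.2 hq.le
  have hpi0 : 0 ≤ (mixRatio γ a z)⁻¹ := inv_nonneg.2 hp.le
  have t₁ : (mixRatio γ a z - mixRatio γ b z) ^ 2 * (mixRatio γ b z)⁻¹ ≤
      8 * (γ * h) ^ 2 * Real.exp 1 ^ 3 * w ^ 8 := by
    calc _ ≤ 4 * (γ * h) ^ 2 * w ^ 4 * (Real.exp 1 * w) := by gcongr
      _ = 4 * (γ * h) ^ 2 * (Real.exp 1 ^ 1 * w ^ 5) := by ring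
      _ ≤ 8 * (γ * h) ^ 2 * (Real.exp 1 ^ 3 * w ^ 8) := by
          gcongr <;> norm_num
      _ = _ := by ring
  have t₂ : (mixRatio γ a z - mixRatio γ b z) ^ 2 *
      ((mixRatio γ a z)⁻¹ + mixRatio γ a z * (mixRatio γ b z)⁻¹ ^ 2) * (Real.exp 1 * w) ≤
      8 * (γ * h) ^ 2 * Real.exp 1 ^ 3 * w ^ 8 := by
    have : (mixRatio γ a z)⁻¹ + mixRatio γ a z * (mixRatio γ b z)⁻¹ ^ 2 ≤
        2 * (Real.exp 1 ^ 2 * w ^ 3) := by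
      have u₁ : (mixRatio γ a z)⁻¹ ≤ Real.exp 1 ^ 2 * w ^ 3 :=
        hpi.trans (by
          calc Real.exp 1 * w = Real.exp 1 ^ 1 * w ^ 1 := by ring
            _ ≤ _ := by gcongr <;> norm_num)
      have u₂ : mixRatio γ a z * (mixRatio γ b z)⁻¹ ^ 2 ≤ Real.exp 1 ^ 2 * w ^ 3 := by
        calc _ ≤ w * (Real.exp 1 * w) ^ 2 := by gcongr
          _ = _ := by ring
      linarith
    calc _ ≤ 4 * (γ * h) ^ 2 * w ^ 4 * (2 * (Real.exp 1 ^ 2 * w ^ 3)) * (Real.exp 1 * w) := by gcongr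
      _ = _ := by ring
  have s₁ := mul_le_mul_of_nonneg_left t₁ ht
  have s₂ := mul_le_mul_of_nonneg_left t₂ (sq_nonneg t)
  linarith

/-! ### Gaussian integrals -/

lemma integrable_exp_mul_abs (t : ℝ) :
    Integrable (fun z => Real.exp (t * |z|)) (gaussianReal 0 1) := by
  have h := (integrable_exp_mul_gaussianReal (μ := 0) (v := 1) t).add
    (integrable_exp_mul_gaussianReal (μ := 0) (v := 1) (-t))
  refine h.mono' (by fun_prop) (ae_of_all _ fun z => ?_)
  rw [Real.norm_eq_abs, abs_of_pos (Real.exp_pos _), Pi.add_apply]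
  rcases abs_choice z with hz | hz <;> rw [hz]
  · linarith [Real.exp_pos (-t * z)]
  · rw [mul_neg, ← neg_mul]
    linarith [Real.exp_pos (t * z)]

lemma integral_exp_mul_gaussian (t : ℝ) :
    ∫ z, Real.exp (t * z) ∂(gaussianReal 0 1) = Real.exp (t ^ 2 / 2) := by
  have := congrFun (mgf_id_gaussianReal (μ := 0) (v := 1)) t
  simpa [mgf] using this

lemma integral_exp_mul_abs_le (t : ℝ) :
    ∫ z, Real.exp (t * |z|) ∂(gaussianReal 0 1) ≤ 2 * Real.exp (t ^ 2 / 2) := by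
  have h := (integrable_exp_mul_gaussianReal (μ := 0) (v := 1) t).add
    (integrable_exp_mul_gaussianReal (μ := 0) (v := 1) (-t))
  refine (integral_mono (integrable_exp_mul_abs t) h fun z => ?_).trans_eq ?_
  · rw [Pi.add_apply]
    rcases abs_choice z with hz | hz <;> simp only [hz]
    · linarith [Real.exp_pos (-t * z)]
    · rw [mul_neg, ← neg_mul]
      linarith [Real.exp_pos (t * z)]
  · rw [integral_add' (integrable_exp_mul_gaussianReal t) (integrable_exp_mul_gaussianReal (-t)),
      integral_exp_mul_gaussian, integral_exp_mul_gaussian, neg_sq]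
    ring

lemma integrable_gaussianRatio (a : ℝ) : Integrable (gaussianRatio a) (gaussianReal 0 1) := by
  have := (integrable_exp_mul_gaussianReal (μ := 0) (v := 1) a).mul_const (Real.exp (-(a ^ 2 / 2)))
  refine this.congr (ae_of_all _ fun z => ?_)
  simp only [gaussianRatio]
  rw [← Real.exp_add, sub_eq_add_neg]

lemma integrable_mixRatio (γ a : ℝ) : Integrable (mixRatio γ a) (gaussianReal 0 1) :=
  (integrable_const _).add ((integrable_gaussianRatio a).const_mul γ)

lemma integral_mixRatio (γ a : ℝ) : ∫ z, mixRatio γ a z ∂(gaussianReal 0 1) = 1 := by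
  have h : ∫ z, gaussianRatio a z ∂(gaussianReal 0 1) = 1 := by
    have : ∀ z, gaussianRatio a z = Real.exp (a * z) * Real.exp (-(a ^ 2 / 2)) := fun z => by
      rw [gaussianRatio, ← Real.exp_add, sub_eq_add_neg]
    simp_rw [this]
    rw [integral_mul_const, integral_exp_mul_gaussian, ← Real.exp_add, add_neg_cancel, Real.exp_zero]
  simp only [mixRatio]
  rw [integral_add (integrable_const _) ((integrable_gaussianRatio a).const_mul γ),
    integral_const_mul, h]
  simp

/-- The law `(1 - γ) N(0, 1) + γ N(a, 1)` of one coordinate, in units of the noise. -/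
noncomputable def mixLaw (γ a : ℝ) : Measure ℝ :=
  (gaussianReal 0 1).withDensity fun z => ENNReal.ofReal (mixRatio γ a z)

lemma isProbabilityMeasure_mixLaw {γ : ℝ} (γ0 : 0 ≤ γ) (γ1 : γ ≤ 1) (a : ℝ) :
    IsProbabilityMeasure (mixLaw γ a) := by
  constructor
  rw [mixLaw, withDensity_apply _ MeasurableSet.univ, setLIntegral_univ,
    ← ofReal_integral_eq_lintegral_ofReal (integrable_mixRatio γ a)
      (ae_of_all _ fun z => (mixRatio_pos γ0 γ1 a z).le), integral_mixRatio, ENNReal.ofReal_one]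

lemma lintegral_mixLaw {γ : ℝ} (a : ℝ) {g : ℝ → ℝ} (hg : Measurable g) (hg0 : ∀ z, 0 ≤ g z) :
    ∫⁻ z, ENNReal.ofReal (g z) ∂mixLaw γ a =
      ∫⁻ z, ENNReal.ofReal (g z * mixRatio γ a z) ∂gaussianReal 0 1 := by
  rw [mixLaw, lintegral_withDensity_eq_lintegral_mul₀
    (measurable_mixRatio γ a).ennreal_ofReal.aemeasurable hg.ennreal_ofReal.aemeasurable]
  congr with z
  rw [Pi.mul_apply, mul_comm, ENNReal.ofReal_mul (hg0 z)]

/-- The moment generating function of the clipped privacy loss is `1 + O((t + t²) γ² h²)`. -/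
lemma lintegral_exp_clipped_loss_le {γ h a b t : ℝ} (γ0 : 0 ≤ γ) (γ1 : γ ≤ 1) (h0 : 0 ≤ h)
    (h1 : h ≤ 1) (ha : |a| ≤ h) (hb : |b| ≤ h) (ht : 0 ≤ t) :
    ∫⁻ z, ENNReal.ofReal
        (Real.exp (min (t * Real.log (mixRatio γ a z / mixRatio γ b z)) (1 + |z|))) ∂mixLaw γ a ≤
      ENNReal.ofReal (1 + (t + t ^ 2) * (16 * Real.exp 35 * (γ * h) ^ 2)) := by
  have hpm := measurable_mixRatio γ a
  have hqm := measurable_mixRatio γ b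
  rw [lintegral_mixLaw a (by fun_prop) fun z => (Real.exp_pos _).le]
  have i₁ := integrable_mixRatio γ a
  have i₂ := integrable_mixRatio γ b
  have i₃ := (integrable_exp_mul_abs 8).const_mul ((t + t ^ 2) * (8 * (γ * h) ^ 2 * Real.exp 3))
  have i₁₂ : Integrable (fun z => t * (mixRatio γ a z - mixRatio γ b z)) (gaussianReal 0 1) :=
    (i₁.sub i₂).const_mul t
  have i₁₂' : Integrable (fun z => mixRatio γ a z + t * (mixRatio γ a z - mixRatio γ b z))
      (gaussianReal 0 1) := i₁.add i₁₂
  have hle := exp_clipped_loss_mul_le γ0 γ1 h0 h1 ha hb ht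
  calc _ ≤ ∫⁻ z, ENNReal.ofReal (mixRatio γ a z + t * (mixRatio γ a z - mixRatio γ b z) +
        (t + t ^ 2) * (8 * (γ * h) ^ 2 * Real.exp 3) * Real.exp (8 * |z|)) ∂gaussianReal 0 1 :=
        lintegral_mono fun z => ENNReal.ofReal_le_ofReal (hle z)
    _ = ENNReal.ofReal (∫ z, (mixRatio γ a z + t * (mixRatio γ a z - mixRatio γ b z) +
        (t + t ^ 2) * (8 * (γ * h) ^ 2 * Real.exp 3) * Real.exp (8 * |z|)) ∂gaussianReal 0 1) := by
        refine (ofReal_integral_eq_lintegral_ofReal (i₁₂'.add i₃) (ae_of_all _ fun z => ?_)).symm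
        exact (mul_nonneg (Real.exp_pos _).le (mixRatio_pos γ0 γ1 a z).le).trans (hle z)
    _ ≤ _ := by
        refine ENNReal.ofReal_le_ofReal ?_
        rw [integral_add i₁₂' i₃, integral_add i₁ i₁₂, integral_const_mul, integral_const_mul,
          integral_sub i₁ i₂, integral_mixRatio, integral_mixRatio, sub_self, mul_zero, add_zero]
        have := integral_exp_mul_abs_le 8
        have e : Real.exp 35 = Real.exp 3 * Real.exp (8 ^ 2 / 2) := by
          rw [← Real.exp_add]
          norm_num
        rw [e]
        have := mul_le_mul_of_nonneg_left this
          (show 0 ≤ (t + t ^ 2) * (8 * (γ * h) ^ 2 * Real.exp 3) by positivity)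
        linarith

/-- The privacy loss exceeds its clipping level only for a noise value so large that the factor
`exp (2 h |z|)` outweighs the smallness of `t γ h`. -/
lemma mixLaw_clipped_le {γ h a b t s T : ℝ} (γ0 : 0 ≤ γ) (γ1 : γ ≤ 1) (h0 : 0 ≤ h)
    (h1 : h ≤ 1) (ha : |a| ≤ h) (hb : |b| ≤ h) (ht : 0 ≤ t) (hs : 0 ≤ s)
    (hT : 2 * Real.exp 1 * (t * (γ * h)) ≤ Real.exp (-T)) :
    mixLaw γ a {z | 1 + |z| < t * Real.log (mixRatio γ a z / mixRatio γ b z)} ≤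
      ENNReal.ofReal (2 * Real.exp (-(s * T) + (4 * (h * s) ^ 2 + 1))) := by
  have hpm := measurable_mixRatio γ a
  have hqm := measurable_mixRatio γ b
  have hset : MeasurableSet {z | 1 + |z| < t * Real.log (mixRatio γ a z / mixRatio γ b z)} :=
    measurableSet_lt (by fun_prop) (by fun_prop)
  have hpt : ∀ z, 1 + |z| < t * Real.log (mixRatio γ a z / mixRatio γ b z) →
      1 ≤ Real.exp (s * (2 * h * |z| - T)) := by
    intro z hz
    refine Real.one_le_exp (mul_nonneg hs ?_)
    have h₁ := hz.trans_le (mul_le_mul_of_nonneg_left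
      (log_mixRatio_div_le γ0 γ1 h0 h1 ha hb z) ht)
    rw [show t * (2 * (γ * h) * (1 + |z|) * Real.exp (2 * h * |z| + 1)) =
      (1 + |z|) * (2 * Real.exp 1 * (t * (γ * h)) * Real.exp (2 * h * |z|)) by
        rw [Real.exp_add]; ring] at h₁
    have h₂ : 1 < 2 * Real.exp 1 * (t * (γ * h)) * Real.exp (2 * h * |z|) := by
      by_contra hcon
      nlinarith [abs_nonneg z]
    have h₃ : 1 < Real.exp (-T) * Real.exp (2 * h * |z|) := h₂.trans_le (by gcongr)
    rw [← Real.exp_add, ← Real.exp_zero, Real.exp_lt_exp] at h₃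
    linarith
  calc mixLaw γ a {z | 1 + |z| < t * Real.log (mixRatio γ a z / mixRatio γ b z)}
      ≤ ∫⁻ z, ENNReal.ofReal (Real.exp (s * (2 * h * |z| - T))) ∂mixLaw γ a := by
        rw [← lintegral_indicator_one hset]
        refine lintegral_mono fun z => ?_
        by_cases hz : z ∈ {z | 1 + |z| < t * Real.log (mixRatio γ a z / mixRatio γ b z)}
        · rw [Set.indicator_of_mem hz, Pi.one_apply, ← ENNReal.ofReal_one]
          exact ENNReal.ofReal_le_ofReal (hpt z hz)
        · rw [Set.indicator_of_notMem hz]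
          exact zero_le
    _ = ∫⁻ z, ENNReal.ofReal (Real.exp (s * (2 * h * |z| - T)) * mixRatio γ a z)
        ∂gaussianReal 0 1 := lintegral_mixLaw a (by fun_prop) fun z => (Real.exp_pos _).le
    _ ≤ ∫⁻ z, ENNReal.ofReal (Real.exp (-(s * T)) * Real.exp ((2 * h * s + 1) * |z|))
        ∂gaussianReal 0 1 := by
        refine lintegral_mono fun z => ENNReal.ofReal_le_ofReal ?_
        have := mixRatio_le_exp γ0 γ1 h0 ha z
        calc _ ≤ Real.exp (s * (2 * h * |z| - T)) * Real.exp |z| := by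
              gcongr
              exact this.trans (Real.exp_le_exp.2 (mul_le_of_le_one_left (abs_nonneg z) h1))
          _ = _ := by
              rw [← Real.exp_add, ← Real.exp_add]
              congr 1
              ring
    _ = ENNReal.ofReal (∫ z, Real.exp (-(s * T)) * Real.exp ((2 * h * s + 1) * |z|)
        ∂gaussianReal 0 1) :=
        (ofReal_integral_eq_lintegral_ofReal ((integrable_exp_mul_abs _).const_mul _)
          (ae_of_all _ fun z => by positivity)).symm
    _ ≤ _ := by
        refine ENNReal.ofReal_le_ofReal ?_
        rw [integral_const_mul]
        have h₁ := integral_exp_mul_abs_le (2 * h * s + 1)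
        have h₂ : Real.exp ((2 * h * s + 1) ^ 2 / 2) ≤ Real.exp (4 * (h * s) ^ 2 + 1) :=
          Real.exp_le_exp.2 (by nlinarith [sq_nonneg (2 * h * s - 1)])
        rw [Real.exp_add]
        have := mul_le_mul_of_nonneg_left (h₁.trans (mul_le_mul_of_nonneg_left h₂ two_pos.le))
          (Real.exp_pos (-(s * T))).le
        linarith

/-! ### Composition over the coordinates -/

/-- A product measure is dominated by another, up to the probabilities that a coordinate's privacy
loss exceeds its clipping level, and a Chernoff bound for the sum of the clipped losses. -/
lemma pi_withDensity_apply_le {ι α : Type*} [Fintype ι] [MeasurableSpace α]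
    {μ : Measure α} [IsProbabilityMeasure μ] {p q : ι → α → ℝ} {y : α → ℝ}
    (hp : ∀ i, Measurable (p i)) (hq : ∀ i, Measurable (q i)) (hy : Measurable y)
    (hp0 : ∀ i z, 0 < p i z) (hq0 : ∀ i z, 0 < q i z)
    [∀ i, IsProbabilityMeasure (μ.withDensity fun z => ENNReal.ofReal (p i z))]
    [∀ i, IsProbabilityMeasure (μ.withDensity fun z => ENNReal.ofReal (q i z))]
    (ε : ℝ) {t : ℝ} (ht : 0 < t) {E : Set (ι → α)} (hE : MeasurableSet E) :
    Measure.pi (fun i => μ.withDensity fun z => ENNReal.ofReal (p i z)) E ≤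
      ENNReal.ofReal (Real.exp ε) *
          Measure.pi (fun i => μ.withDensity fun z => ENNReal.ofReal (q i z)) E +
        (∑ i, μ.withDensity (fun z => ENNReal.ofReal (p i z))
            {z | y z < t * Real.log (p i z / q i z)} +
          ENNReal.ofReal (Real.exp (-(t * ε))) *
            ∏ i, ∫⁻ z, ENNReal.ofReal (Real.exp (min (t * Real.log (p i z / q i z)) (y z)))
              ∂μ.withDensity fun z => ENNReal.ofReal (p i z)) := by
  set P := Measure.pi (fun i => μ.withDensity fun z => ENNReal.ofReal (p i z)) with hP
  set Q := Measure.pi (fun i => μ.withDensity fun z => ENNReal.ofReal (q i z)) with hQ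
  have hPd : P = (Measure.pi fun _ => μ).withDensity fun x => ∏ i, ENNReal.ofReal (p i (x i)) :=
    pi_withDensity (fun _ => μ) fun i => (hp i).ennreal_ofReal
  have hQd : Q = (Measure.pi fun _ => μ).withDensity fun x => ∏ i, ENNReal.ofReal (q i (x i)) :=
    pi_withDensity (fun _ => μ) fun i => (hq i).ennreal_ofReal
  let G : Set (ι → α) := {x | ∏ i, p i (x i) ≤ Real.exp ε * ∏ i, q i (x i)}
  have hG : MeasurableSet G := measurableSet_le (by fun_prop) (by fun_prop)
  let Bad : ι → Set (ι → α) := fun i => {x | y (x i) < t * Real.log (p i (x i) / q i (x i))}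
  let S : (ι → α) → ℝ := fun x => ∑ i, min (t * Real.log (p i (x i) / q i (x i))) (y (x i))
  -- outside `G`, if no loss is clipped, the sum of the clipped losses exceeds `t ε`
  have hcover : E ⊆ (E ∩ G) ∪ ((⋃ i, Bad i) ∪ {x | t * ε ≤ S x}) := by
    intro x hx
    by_cases hxG : x ∈ G
    · exact Or.inl ⟨hx, hxG⟩
    by_cases hb : ∃ i, x ∈ Bad i
    · exact Or.inr (Or.inl (Set.mem_iUnion.2 hb))
    refine Or.inr (Or.inr ?_)
    have hlt : Real.exp ε * ∏ i, q i (x i) < ∏ i, p i (x i) := not_le.1 hxG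
    have hqp : 0 < ∏ i, q i (x i) := Finset.prod_pos fun i _ => hq0 i _
    have hpp : 0 < ∏ i, p i (x i) := Finset.prod_pos fun i _ => hp0 i _
    rw [← lt_div_iff₀ hqp, ← Real.lt_log_iff_exp_lt (by positivity), ← Finset.prod_div_distrib,
      Real.log_prod fun i _ => (div_pos (hp0 i _) (hq0 i _)).ne'] at hlt
    have hS : S x = t * ∑ i, Real.log (p i (x i) / q i (x i)) := by
      rw [Finset.mul_sum]
      exact Finset.sum_congr rfl fun i _ => min_eq_left (not_lt.1 fun h => hb ⟨i, h⟩)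
    change t * ε ≤ S x
    rw [hS]
    exact mul_le_mul_of_nonneg_left hlt.le ht.le
  have hgood : P (E ∩ G) ≤ ENNReal.ofReal (Real.exp ε) * Q E := by
    rw [hPd, hQd, withDensity_apply _ (hE.inter hG), withDensity_apply _ hE,
      ← lintegral_const_mul' _ _ ENNReal.ofReal_ne_top]
    refine (setLIntegral_mono' (hE.inter hG) fun x hx => ?_).trans
      (lintegral_mono_set Set.inter_subset_left)
    rw [← ENNReal.ofReal_prod_of_nonneg fun i _ => (hp0 i _).le,
      ← ENNReal.ofReal_prod_of_nonneg fun i _ => (hq0 i _).le,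
      ← ENNReal.ofReal_mul (Real.exp_pos _).le]
    exact ENNReal.ofReal_le_ofReal hx.2
  have hbad : ∀ i, P (Bad i) = μ.withDensity (fun z => ENNReal.ofReal (p i z))
      {z | y z < t * Real.log (p i z / q i z)} := by
    intro i
    have hm : MeasurableSet {z | y z < t * Real.log (p i z / q i z)} :=
      measurableSet_lt (by fun_prop) (by fun_prop)
    exact (measurePreserving_eval (fun i => μ.withDensity fun z => ENNReal.ofReal (p i z))
      i).measure_preimage hm.nullMeasurableSet
  have hchernoff : P {x | t * ε ≤ S x} ≤ ENNReal.ofReal (Real.exp (-(t * ε))) *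
      ∏ i, ∫⁻ z, ENNReal.ofReal (Real.exp (min (t * Real.log (p i z / q i z)) (y z)))
        ∂μ.withDensity fun z => ENNReal.ofReal (p i z) := by
    rw [← lintegral_pi_prod (fun i => μ.withDensity fun z => ENNReal.ofReal (p i z))
      fun i => by fun_prop, ← lintegral_const_mul' _ _ ENNReal.ofReal_ne_top]
    have hSm : MeasurableSet {x | t * ε ≤ S x} := measurableSet_le (by fun_prop) (by fun_prop)
    rw [← lintegral_indicator_one hSm]
    refine lintegral_mono fun x => ?_
    by_cases hx : x ∈ {x | t * ε ≤ S x}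
    · rw [Set.indicator_of_mem hx, Pi.one_apply,
        ← ENNReal.ofReal_prod_of_nonneg fun i _ => (Real.exp_pos _).le, ← Real.exp_sum,
        ← ENNReal.ofReal_mul (Real.exp_pos _).le, ← Real.exp_add, ← ENNReal.ofReal_one]
      refine ENNReal.ofReal_le_ofReal (Real.one_le_exp ?_)
      have : t * ε ≤ S x := hx
      linarith
    · rw [Set.indicator_of_notMem hx]
      exact zero_le
  calc P E ≤ P (E ∩ G) + (P (⋃ i, Bad i) + P {x | t * ε ≤ S x}) :=
        (measure_mono hcover).trans ((measure_union_le _ _).trans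
          (add_le_add le_rfl (measure_union_le _ _)))
    _ ≤ _ := by
        refine add_le_add hgood (add_le_add ?_ hchernoff)
        refine (measure_iUnion_fintype_le _ _).trans_eq ?_
        exact Finset.sum_congr rfl fun i _ => hbad i

section Constants

variable {d : ℕ} {γ h A L ε t g : ℝ}

/-- The bounds for the `d` moment generating functions use up at most half of the Chernoff exponent
`t ε`. -/
lemma chernoff_exponent_le (hg0 : 0 ≤ g) (hε : 0 < ε) (hA : 1 ≤ A)
    (hAL : L + 1 ≤ A * L) (hlogd : 0 ≤ Real.log d) (hL : 0 < L) (htε : t * ε = 2 * (L + 1))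
    (ht : 0 ≤ t)
    (hnoise : 64 * Real.exp 35 * A ^ 2 *
      (g * d * (L + Real.log d + ε) * (L + Real.log d)) ≤ ε ^ 2) :
    d * ((t + t ^ 2) * (16 * Real.exp 35 * g)) ≤ L + 1 := by
  set D := L + Real.log d with hD
  set K := Real.exp 35 with hK
  have hK0 : 0 < K := Real.exp_pos _
  have hDL : L ≤ D := by linarith
  have hAD : 1 ≤ A * D := by nlinarith
  have e₁ : (1 + t) * ε ≤ 2 * A * (D + ε) := by
    have : (1 + t) * ε = ε + 2 * (L + 1) := by rw [add_mul, htε]; ring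
    nlinarith
  have e₂ : 64 * K * A ^ 2 * (g * d * (D + ε) * D) ≤ ε ^ 2 := hnoise
  have e₃ : 64 * K * A * (g * d * (D + ε)) ≤ ε ^ 2 := by
    have : 0 ≤ 64 * K * A * (g * d * (D + ε)) := by positivity
    nlinarith
  have e₄ : d * ((1 + t) * ε * (32 * K * g)) ≤ ε ^ 2 := by
    calc d * ((1 + t) * ε * (32 * K * g)) ≤ d * (2 * A * (D + ε) * (32 * K * g)) := by gcongr
      _ = 64 * K * A * (g * d * (D + ε)) := by ring
      _ ≤ _ := e₃
  have e₅ : (d * ((t + t ^ 2) * (16 * K * g))) * ε ^ 2 ≤ (L + 1) * ε ^ 2 := by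
    calc _ = t * ε / 2 * (d * ((1 + t) * ε * (32 * K * g))) := by ring
      _ ≤ t * ε / 2 * ε ^ 2 := by gcongr
      _ = _ := by rw [htε]; ring
  exact le_of_mul_le_mul_right e₅ (by positivity)

/-- The choice `t = 2 (L + 1) / ε` of the exponent makes `t γ h` a small multiple of `1 / √d`. -/
lemma clipping_threshold_le (γ0 : 0 ≤ γ) (h0 : 0 ≤ h) (hd : (1 : ℝ) ≤ d) (hε : 0 < ε) (hA : 1 ≤ A)
    (hAL : L + 1 ≤ A * L) (hL : 0 < L) (htε : t * ε = 2 * (L + 1)) (ht : 0 ≤ t)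
    (hnoise : 64 * Real.exp 35 * A ^ 2 *
      ((γ * h) ^ 2 * d * (L + Real.log d + ε) * (L + Real.log d)) ≤ ε ^ 2) :
    2 * Real.exp 1 * (t * (γ * h)) ≤ Real.exp (-(2 + Real.log d / 2)) := by
  have hlogd : 0 ≤ Real.log d := Real.log_nonneg hd
  set D := L + Real.log d with hD
  set K := Real.exp 35 with hK
  have hK0 : 0 < K := Real.exp_pos _
  have hDL : L ≤ D := by linarith
  set T := 2 + Real.log d / 2 with hT_def
  set g := (γ * h) ^ 2 with hg
  have hg0 : 0 ≤ g := sq_nonneg _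
  refine (pow_le_pow_iff_left₀ (by positivity) (Real.exp_pos _).le two_ne_zero).1 ?_
  have e₁ : Real.exp (-T) ^ 2 = Real.exp (-4) / d := by
    rw [← Real.exp_nat_mul, hT_def, show ((2 : ℕ) : ℝ) * -(2 + Real.log d / 2) =
      -4 - Real.log d by push_cast; ring, Real.exp_sub, Real.exp_log (by positivity)]
  have e₂ : 64 * K * A ^ 2 * (g * d * D ^ 2) ≤ ε ^ 2 := by
    refine le_trans ?_ hnoise
    rw [sq D, ← mul_assoc (g * d) D D]
    gcongr
    linarith
  have e₃ : t ^ 2 * ε ^ 2 ≤ 4 * (A ^ 2 * D ^ 2) := by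
    rw [← mul_pow, htε, mul_pow, ← mul_pow A]
    have : L + 1 ≤ A * D := by nlinarith
    have : (L + 1) ^ 2 ≤ (A * D) ^ 2 := by gcongr
    linarith
  have e₄ : 16 * K * (t ^ 2 * g * d) ≤ 1 := by
    have : 16 * K * (t ^ 2 * g * d) * ε ^ 2 ≤ 1 * ε ^ 2 := by
      calc _ = 16 * K * (g * d) * (t ^ 2 * ε ^ 2) := by ring
        _ ≤ 16 * K * (g * d) * (4 * (A ^ 2 * D ^ 2)) := by gcongr
        _ = 64 * K * A ^ 2 * (g * d * D ^ 2) := by ring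
        _ ≤ _ := by linarith
    exact le_of_mul_le_mul_right this (by positivity)
  rw [e₁, le_div_iff₀ (by positivity)]
  have e₅ : Real.exp 1 ^ 2 * Real.exp 4 ≤ K := by
    rw [← Real.exp_nat_mul, ← Real.exp_add, hK]
    exact Real.exp_le_exp.2 (by norm_num)
  have e₆ : Real.exp (-4) * Real.exp 4 = 1 := by rw [← Real.exp_add]; norm_num
  have e₇ : (2 * Real.exp 1 * (t * (γ * h))) ^ 2 * d * Real.exp 4 ≤ Real.exp (-4) * Real.exp 4 := by
    rw [e₆]
    calc _ = 4 * (Real.exp 1 ^ 2 * Real.exp 4) * (t ^ 2 * g * d) := by rw [hg]; ring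
      _ ≤ 4 * K * (t ^ 2 * g * d) := by gcongr
      _ ≤ 16 * K * (t ^ 2 * g * d) := by gcongr; norm_num
      _ ≤ 1 := e₄
  exact le_of_mul_le_mul_right e₇ (Real.exp_pos _)

/-- The `d` excess probabilities, for the exponent `s = 2 (L + 1)` in Markov's inequality, add up to
at most `δ / 2`. -/
lemma tail_bound_le (hd : (1 : ℝ) ≤ d) (hA : 1 ≤ A) (hAL : L + 1 ≤ A * L) (hL : 0 < L)
    (hnoise : 64 * Real.exp 35 * A ^ 2 * (h ^ 2 * L) ≤ 1) :
    d * (2 * Real.exp (-(2 * (L + 1) * (2 + Real.log d / 2)) +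
      (4 * (h * (2 * (L + 1))) ^ 2 + 1))) ≤ Real.exp (-L) / 2 := by
  have hlogd : 0 ≤ Real.log d := Real.log_nonneg hd
  have hK1 : 1 ≤ Real.exp 35 := Real.one_le_exp (by norm_num)
  set K := Real.exp 35 with hK
  set s := 2 * (L + 1) with hs_def
  set T := 2 + Real.log d / 2 with hT_def
  have e₁ : 4 * (h * s) ^ 2 ≤ L + 1 := by
    have : 16 * (h ^ 2 * (A * L)) ≤ 1 := by
      refine le_trans ?_ hnoise
      have : 0 ≤ h ^ 2 * L := by positivity
      have : 16 * A ≤ 64 * K * A ^ 2 := by nlinarith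
      nlinarith
    calc 4 * (h * s) ^ 2 = (L + 1) * (16 * (h ^ 2 * (L + 1))) := by rw [hs_def]; ring
      _ ≤ (L + 1) * (16 * (h ^ 2 * (A * L))) := by gcongr
      _ ≤ (L + 1) * 1 := by gcongr
      _ = _ := mul_one _
  have e₂ : Real.log d + 2 * Real.log 2 + (-(s * T) + (4 * (h * s) ^ 2 + 1)) ≤ -L := by
    have := Real.log_two_lt_d9
    have : 0 ≤ L * Real.log d := by positivity
    have : s * T = 4 * (L + 1) + L * Real.log d + Real.log d := by
      rw [hs_def, hT_def]
      ring
    linarith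
  have e₃ := Real.exp_le_exp.2 e₂
  rw [Real.exp_add, Real.exp_add (Real.log d), Real.exp_log (by positivity), two_mul (Real.log 2),
    Real.exp_add (Real.log 2), Real.exp_log two_pos] at e₃
  linarith

end Constants

/-- Products of `d` subsampled Gaussians are `(ε, δ)`-indistinguishable, where `h` bounds the shifts
and `L = log (1 / δ)`. -/
lemma pi_mixLaw_apply_le {d : ℕ} (hd : 1 ≤ d) {γ h A L ε : ℝ} (γ0 : 0 ≤ γ) (γ1 : γ ≤ 1)
    (h0 : 0 ≤ h) (hL : 0 < L) (hε : 0 < ε) (hA : 1 ≤ A) (hAL : L + 1 ≤ A * L)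
    (hnoise₁ : 64 * Real.exp 35 * A ^ 2 * (h ^ 2 * L) ≤ 1)
    (hnoise₂ : 64 * Real.exp 35 * A ^ 2 *
      ((γ * h) ^ 2 * d * (L + Real.log d + ε) * (L + Real.log d)) ≤ ε ^ 2)
    {a b : Fin d → ℝ} (ha : ∀ j, |a j| ≤ h) (hb : ∀ j, |b j| ≤ h)
    {E : Set (Fin d → ℝ)} (hE : MeasurableSet E) :
    Measure.pi (fun j => mixLaw γ (a j)) E ≤
      ENNReal.ofReal (Real.exp ε) * Measure.pi (fun j => mixLaw γ (b j)) E +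
        ENNReal.ofReal (Real.exp (-L)) := by
  have hd1 : (1 : ℝ) ≤ d := by exact_mod_cast hd
  have hlogd : 0 ≤ Real.log d := Real.log_nonneg hd1
  have hK1 : 1 ≤ Real.exp 35 := Real.one_le_exp (by norm_num)
  set K := Real.exp 35 with hK
  have h1 : h ≤ 1 := by
    have : h ^ 2 * 1 ≤ h ^ 2 * (64 * K * A ^ 2 * L) := by
      have : 1 ≤ 64 * K * A ^ 2 * L := by
        have h₁ : 1 ≤ A * L := by linarith
        have h₂ : 1 ≤ 64 * K * A := by nlinarith
        nlinarith
      gcongr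
    have h₂ : h ^ 2 ≤ 1 := by linarith
    nlinarith
  -- the exponent for which `exp (-t ε / 2) ≤ δ / e`, leaving room for the excess probabilities
  set t := 2 * (L + 1) / ε with ht_def
  have ht : 0 < t := by positivity
  have htε : t * ε = 2 * (L + 1) := by
    rw [ht_def]
    field_simp
  set g := (γ * h) ^ 2 with hg
  have hg0 : 0 ≤ g := sq_nonneg _
  have hmgf : d * ((t + t ^ 2) * (16 * K * g)) ≤ L + 1 :=
    chernoff_exponent_le hg0 hε hA hAL hlogd hL htε ht.le hnoise₂
  set T := 2 + Real.log d / 2 with hT_def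
  have hT : 2 * Real.exp 1 * (t * (γ * h)) ≤ Real.exp (-T) :=
    clipping_threshold_le γ0 h0 hd1 hε hA hAL hL htε ht.le hnoise₂
  set s := 2 * (L + 1) with hs_def
  have hs : 0 ≤ s := by positivity
  have htail : d * (2 * Real.exp (-(s * T) + (4 * (h * s) ^ 2 + 1))) ≤ Real.exp (-L) / 2 :=
    tail_bound_le hd1 hA hAL hL hnoise₁
  have hexp : Real.exp (-(t * ε)) * Real.exp (L + 1) ≤ Real.exp (-L) / 2 := by
    rw [← Real.exp_add, htε, show -(2 * (L + 1)) + (L + 1) = -L - 1 by ring, Real.exp_sub]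
    have := Real.exp_one_gt_d9
    gcongr
    linarith
  have hmeas : ∀ j, Measurable (mixRatio γ (a j)) := fun j => measurable_mixRatio γ _
  have hmeas' : ∀ j, Measurable (mixRatio γ (b j)) := fun j => measurable_mixRatio γ _
  have : ∀ j, IsProbabilityMeasure
      ((gaussianReal 0 1).withDensity fun z => ENNReal.ofReal (mixRatio γ (a j) z)) := fun j =>
    isProbabilityMeasure_mixLaw γ0 γ1 (a j)
  have : ∀ j, IsProbabilityMeasure
      ((gaussianReal 0 1).withDensity fun z => ENNReal.ofReal (mixRatio γ (b j) z)) := fun j =>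
    isProbabilityMeasure_mixLaw γ0 γ1 (b j)
  refine (pi_withDensity_apply_le (y := fun z => 1 + |z|) hmeas hmeas' (by fun_prop)
    (fun j => mixRatio_pos γ0 γ1 (a j)) (fun j => mixRatio_pos γ0 γ1 (b j)) ε ht hE).trans ?_
  refine add_le_add le_rfl ?_
  have hsplit : ENNReal.ofReal (Real.exp (-L)) =
      ENNReal.ofReal (Real.exp (-L) / 2) + ENNReal.ofReal (Real.exp (-L) / 2) := by
    rw [← ENNReal.ofReal_add (by positivity) (by positivity), add_halves]
  rw [hsplit]
  refine add_le_add ?_ ?_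
  · calc _ ≤ ∑ _j : Fin d, ENNReal.ofReal (2 * Real.exp (-(s * T) + (4 * (h * s) ^ 2 + 1))) :=
          Finset.sum_le_sum fun j _ => mixLaw_clipped_le γ0 γ1 h0 h1 (ha j) (hb j) ht.le hs hT
      _ = ENNReal.ofReal (d * (2 * Real.exp (-(s * T) + (4 * (h * s) ^ 2 + 1)))) := by
          rw [Finset.sum_const, Finset.card_univ, Fintype.card_fin, nsmul_eq_mul,
            ENNReal.ofReal_mul (Nat.cast_nonneg d), ENNReal.ofReal_natCast]
      _ ≤ _ := ENNReal.ofReal_le_ofReal htail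
  · calc _ ≤ ENNReal.ofReal (Real.exp (-(t * ε))) *
            ∏ _j : Fin d, ENNReal.ofReal (1 + (t + t ^ 2) * (16 * K * g)) := by
          gcongr with j
          exact lintegral_exp_clipped_loss_le γ0 γ1 h0 h1 (ha j) (hb j) ht.le
      _ = ENNReal.ofReal (Real.exp (-(t * ε)) * (1 + (t + t ^ 2) * (16 * K * g)) ^ d) := by
          rw [Finset.prod_const, Finset.card_univ, Fintype.card_fin,
            ENNReal.ofReal_mul (Real.exp_pos _).le, ENNReal.ofReal_pow (by positivity)]
      _ ≤ _ := by
          refine ENNReal.ofReal_le_ofReal (le_trans ?_ hexp)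
          gcongr
          calc (1 + (t + t ^ 2) * (16 * K * g)) ^ d ≤ Real.exp ((t + t ^ 2) * (16 * K * g)) ^ d := by
                gcongr
                linarith [Real.add_one_le_exp ((t + t ^ 2) * (16 * K * g))]
            _ = Real.exp (d * ((t + t ^ 2) * (16 * K * g))) := (Real.exp_nat_mul _ d).symm
            _ ≤ _ := Real.exp_le_exp.2 hmgf

/-! ### Privacy of the mechanism -/

lemma measurePreserving_select_add {γ : unitInterval} (a : ℝ) :
    MeasurePreserving (fun p : Bool × ℝ => (if p.1 = true then a else 0) + p.2)
      ((bernoulliMeasure true false γ).prod (gaussianReal 0 1)) (mixLaw γ a) := by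
  have hm : Measurable fun p : Bool × ℝ => (if p.1 = true then a else 0) + p.2 := by
    have : Measurable fun b : Bool => if b = true then a else 0 := .of_discrete
    exact (this.comp measurable_fst).add measurable_snd
  refine ⟨hm, Measure.ext_of_lintegral _ fun f hf => ?_⟩
  have hshift : ∀ b : ℝ, ∫⁻ z, f (b + z) ∂gaussianReal 0 1 =
      ∫⁻ z, ENNReal.ofReal (gaussianRatio b z) * f z ∂gaussianReal 0 1 := by
    intro b
    have h₁ := lintegral_map (μ := gaussianReal 0 1) hf (measurable_const_add b)
    rw [gaussianReal_map_const_add, zero_add] at h₁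
    have hr : Measurable (gaussianRatio b) := by unfold gaussianRatio; fun_prop
    rw [← h₁, gaussianReal_of_var_ne_zero _ one_ne_zero, gaussianReal_of_var_ne_zero _ one_ne_zero,
      lintegral_withDensity_eq_lintegral_mul₀ (measurable_gaussianPDF b 1).aemeasurable
        hf.aemeasurable,
      lintegral_withDensity_eq_lintegral_mul₀ (measurable_gaussianPDF 0 1).aemeasurable
        (g := fun z => ENNReal.ofReal (gaussianRatio b z) * f z)
        (hr.ennreal_ofReal.mul hf).aemeasurable]
    congr with z
    simp only [Pi.mul_apply]
    rw [← mul_assoc, gaussianPDF, gaussianPDF, ← ENNReal.ofReal_mul (gaussianPDFReal_nonneg _ _ _)]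
    congr 2
    rw [gaussianPDFReal, gaussianPDFReal, gaussianRatio, mul_assoc _ _ (Real.exp (b * z - b ^ 2 / 2)),
      ← Real.exp_add]
    congr 2
    simp only [NNReal.coe_one]
    ring
  have hr : Measurable (gaussianRatio a) := by unfold gaussianRatio; fun_prop
  rw [lintegral_map hf hm, lintegral_prod (fun p : Bool × ℝ => f ((if p.1 = true then a else 0) + p.2))
      (hf.comp hm).aemeasurable, bernoulliMeasure_def,
    lintegral_add_measure, lintegral_smul_measure, lintegral_smul_measure, lintegral_dirac,
    lintegral_dirac, mixLaw, lintegral_withDensity_eq_lintegral_mul₀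
      (measurable_mixRatio γ a).ennreal_ofReal.aemeasurable hf.aemeasurable]
  simp only [if_true, Bool.false_eq_true, if_false, zero_add]
  rw [hshift a]
  have e₁ : ∀ z, ENNReal.ofReal (mixRatio γ a z) * f z =
      ENNReal.ofReal γ * (ENNReal.ofReal (gaussianRatio a z) * f z) +
        ENNReal.ofReal (1 - γ) * f z := by
    intro z
    have h₁ : 0 ≤ gaussianRatio a z := (Real.exp_pos _).le
    rw [mixRatio, ENNReal.ofReal_add (sub_nonneg.2 γ.2.2) (mul_nonneg γ.2.1 h₁),
      ENNReal.ofReal_mul γ.2.1]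
    ring
  simp only [Pi.mul_apply]
  simp_rw [e₁]
  rw [lintegral_add_left (by fun_prop), lintegral_const_mul _ (by fun_prop),
    lintegral_const_mul _ hf, ENNReal.smul_def, ENNReal.smul_def, smul_eq_mul, smul_eq_mul]
  congr 3
  · exact (Real.toNNReal_of_nonneg γ.2.1).symm
  · exact (Real.toNNReal_of_nonneg (sub_nonneg.2 γ.2.2)).symm

/-- The law of the output as a function of the selection variables of one client and of the noise,
when the selection variables of the other clients are fixed. -/
lemma select_add_gaussianVec_apply {d : ℕ} {γ : unitInterval} {σ : ℝ} (hσ : 0 < σ)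
    (s x : Fin d → ℝ) {E : Set (Fin d → ℝ)} (hE : MeasurableSet E) :
    ((Measure.pi fun _ : Fin d => bernoulliMeasure true false γ).prod (gaussianVec d σ))
        {p | (fun j => s j + (if p.1 j = true then x j else 0) + p.2 j) ∈ E} =
      Measure.pi (fun j => mixLaw γ (x j / σ)) {w | (fun j => s j + σ * w j) ∈ E} := by
  have := fun a => isProbabilityMeasure_mixLaw γ.2.1 γ.2.2 a
  have hscale : MeasurePreserving (fun (z : Fin d → ℝ) j => σ * z j)
      (Measure.pi fun _ => gaussianReal 0 1) (gaussianVec d σ) := by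
    refine measurePreserving_pi _ _ fun j => ⟨by fun_prop, ?_⟩
    rw [gaussianReal_map_const_mul, mul_zero, mul_one]
    congr 1
    ext
    simp [Real.coe_toNNReal _ (sq_nonneg σ)]
  have h₁ := (MeasurePreserving.id (Measure.pi fun _ : Fin d => bernoulliMeasure true false γ)).prod
    hscale
  have h₂ := (measurePreserving_arrowProdEquivProdArrow Bool ℝ (Fin d)
    (fun _ => bernoulliMeasure true false γ) (fun _ => gaussianReal 0 1)).symm
  have h₃ := measurePreserving_pi _ _ fun j : Fin d =>
    measurePreserving_select_add (γ := γ) (x j / σ)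
  have hsel : Measurable fun b : Fin d → Bool => fun j => s j + (if b j = true then x j else 0) :=
    .of_discrete
  have hE₁ : MeasurableSet {p : (Fin d → Bool) × (Fin d → ℝ) |
      (fun j => s j + (if p.1 j = true then x j else 0) + p.2 j) ∈ E} :=
    ((hsel.comp measurable_fst).add measurable_snd) hE
  have hE₂ : MeasurableSet {w : Fin d → ℝ | (fun j => s j + σ * w j) ∈ E} := by
    have : Measurable fun w : Fin d → ℝ => fun j => s j + σ * w j := by fun_prop
    exact this hE
  rw [← h₁.measure_preimage hE₁.nullMeasurableSet,
    ← (h₃.comp h₂).measure_preimage hE₂.nullMeasurableSet]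
  congr 1
  ext p
  have : ∀ j, s j + (if p.1 j = true then x j else 0) + σ * p.2 j =
      s j + σ * ((if p.1 j = true then x j / σ else 0) + p.2 j) := by
    intro j
    split_ifs
    · field_simp
      ring
    · ring
  have e : (fun j => s j + (if p.1 j = true then x j else 0) + σ * p.2 j) =
      fun j => s j + σ * ((if p.1 j = true then x j / σ else 0) + p.2 j) := funext this
  change (fun j => s j + (if p.1 j = true then x j else 0) + σ * p.2 j) ∈ E ↔
    (fun j => s j + σ * ((if p.1 j = true then x j / σ else 0) + p.2 j)) ∈ E
  rw [e]

/-- The part of the subsampled mean that does not depend on client `i`. -/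
noncomputable def othersMean {m d : ℕ} (γ : ℝ) (x : Fin (m + 1) → Fin d → ℝ) (i : Fin (m + 1))
    (R : Fin m → Fin d → Bool) (j : Fin d) : ℝ :=
  (γ * (m + 1 : ℕ))⁻¹ * ∑ k, if R k j = true then x (i.succAbove k) j else 0

/-- The output law as a mixture over the selection variables of the clients other than `i`; only
client `i`'s data enters the product measure. -/
lemma outputLaw_apply {m d : ℕ} {γ : unitInterval} {σ : ℝ} (hγ : 0 < (γ : ℝ)) (hσ : 0 < σ)
    (x : Fin (m + 1) → Fin d → ℝ) (i : Fin (m + 1)) {E : Set (Fin d → ℝ)} (hE : MeasurableSet E) :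
    outputLaw γ σ x E = ∫⁻ R : Fin m → Fin d → Bool,
      Measure.pi (fun j => mixLaw γ ((γ * (m + 1 : ℕ) : ℝ)⁻¹ * x i j / σ))
        {w | (fun j => othersMean γ x i R j + σ * w j) ∈ E}
      ∂(Measure.pi fun _ => Measure.pi fun _ => bernoulliMeasure true false γ) := by
  have hmp := measurePreserving_error (n := m + 1) (by omega) hγ hσ x
  have hadd : Measurable fun p : (Fin (m + 1) → Fin d → Bool) × (Fin d → ℝ) =>
      subsampledMean γ x p.1 + p.2 := by
    have : Measurable fun B : Fin (m + 1) → Fin d → Bool => subsampledMean γ x B := .of_discrete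
    exact (this.comp measurable_fst).add measurable_snd
  have hout : output γ σ x = (fun p : (Fin (m + 1) → Fin d → Bool) × (Fin d → ℝ) =>
      subsampledMean γ x p.1 + p.2) ∘
      fun ω => (ω.1, output γ σ x ω - subsampledMean γ x ω.1) := by
    ext1 ω
    simp
  have hE' := hadd hE
  rw [outputLaw, hout, ← Measure.map_map hadd hmp.measurable, hmp.map_eq, Measure.map_apply hadd hE,
    Measure.prod_apply hE']
  have hsplit := (measurePreserving_piFinSuccAbove (fun _ : Fin (m + 1) =>
    Measure.pi fun _ : Fin d => bernoulliMeasure true false γ) i).symm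
  rw [selectionLaw, ← hsplit.lintegral_comp (measurable_of_finite _),
    lintegral_prod_symm _ (measurable_of_finite _).aemeasurable]
  refine lintegral_congr fun R => ?_
  have hE₁ : MeasurableSet {p : (Fin d → Bool) × (Fin d → ℝ) |
      (fun j => othersMean γ x i R j +
        (if p.1 j = true then (γ * (m + 1 : ℕ) : ℝ)⁻¹ * x i j else 0) + p.2 j) ∈ E} := by
    have hsel : Measurable fun b : Fin d → Bool => fun j => othersMean γ x i R j +
        (if b j = true then (γ * (m + 1 : ℕ) : ℝ)⁻¹ * x i j else 0) := .of_discrete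
    exact ((hsel.comp measurable_fst).add measurable_snd) hE
  rw [← select_add_gaussianVec_apply hσ _ _ hE, Measure.prod_apply hE₁]
  refine lintegral_congr fun b => ?_
  congr 1
  ext z
  have e : subsampledMean γ x ((MeasurableEquiv.piFinSuccAbove (fun _ => Fin d → Bool) i).symm (b, R))
      + z = fun j => othersMean γ x i R j +
        (if b j = true then (γ * (m + 1 : ℕ) : ℝ)⁻¹ * x i j else 0) + z j := by
    ext j
    rw [Pi.add_apply, subsampledMean, Fin.sum_univ_succAbove _ i, othersMean]
    simp only [MeasurableEquiv.piFinSuccAbove_symm_apply, Fin.insertNthEquiv_apply,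
      Fin.insertNth_apply_same, Fin.insertNth_apply_succAbove]
    split_ifs <;> ring
  change subsampledMean γ x _ + z ∈ E ↔ _
  rw [e]
  rfl

lemma isDP_outputLaw {n d : ℕ} {γ : unitInterval} {c σ A ε δ : ℝ} (hn : 1 ≤ n) (hd : 1 ≤ d)
    (hγ : 0 < (γ : ℝ)) (hc : 0 < c) (hσ : 0 < σ) (hε : 0 < ε) (hδ : 0 < δ) (hδ1 : δ < 1)
    (hA : 1 ≤ A) (hAL : Real.log (1 / δ) + 1 ≤ A * Real.log (1 / δ))
    (hnoise₁ : 64 * Real.exp 35 * A ^ 2 * ((c / (σ * γ * n)) ^ 2 * Real.log (1 / δ)) ≤ 1)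
    (hnoise₂ : 64 * Real.exp 35 * A ^ 2 * ((γ * (c / (σ * γ * n))) ^ 2 * d *
      (Real.log (1 / δ) + Real.log d + ε) * (Real.log (1 / δ) + Real.log d)) ≤ ε ^ 2) :
    IsDP (Adjacent (n := n) (d := d) (c := c)) (fun x => outputLaw γ σ x.1) ε δ := by
  rintro x x' ⟨i, hi⟩ E hE
  obtain ⟨m, rfl⟩ : ∃ m, n = m + 1 := ⟨n - 1, by omega⟩
  have hn' : (0 : ℝ) < (m + 1 : ℕ) := by positivity
  have hL : 0 < Real.log (1 / δ) := Real.log_pos ((one_lt_div hδ).2 hδ1)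
  have hbound : ∀ y : BoxData (m + 1) d c, ∀ j,
      |(γ * (m + 1 : ℕ) : ℝ)⁻¹ * y.1 i j / σ| ≤ c / (σ * γ * (m + 1 : ℕ)) := by
    intro y j
    have hy : |y.1 i j| ≤ c := abs_le.2 (y.2 i j)
    rw [abs_div, abs_mul, abs_of_pos hσ, abs_of_pos (inv_pos.2 (mul_pos hγ hn'))]
    calc _ ≤ (γ * (m + 1 : ℕ) : ℝ)⁻¹ * c / σ := by gcongr
      _ = _ := by field_simp
  have hexpL : Real.exp (-Real.log (1 / δ)) = δ := by
    rw [one_div, Real.log_inv, neg_neg, Real.exp_log hδ]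
  have hothers : ∀ R j, othersMean γ x.1 i R j = othersMean γ x'.1 i R j := by
    intro R j
    rw [othersMean, othersMean]
    congr 1
    refine Finset.sum_congr rfl fun k _ => ?_
    rw [hi _ (Fin.succAbove_ne i k)]
  dsimp only
  rw [outputLaw_apply hγ hσ x.1 i hE, outputLaw_apply hγ hσ x'.1 i hE,
    ← lintegral_const_mul' _ _ ENNReal.ofReal_ne_top]
  calc _ ≤ ∫⁻ R : Fin m → Fin d → Bool, (ENNReal.ofReal (Real.exp ε) *
          Measure.pi (fun j => mixLaw γ ((γ * (m + 1 : ℕ) : ℝ)⁻¹ * x'.1 i j / σ))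
            {w | (fun j => othersMean γ x'.1 i R j + σ * w j) ∈ E} + ENNReal.ofReal δ)
        ∂(Measure.pi fun _ => Measure.pi fun _ => bernoulliMeasure true false γ) := by
        refine lintegral_mono fun R => ?_
        simp_rw [hothers R]
        have hE' : MeasurableSet {w : Fin d → ℝ | (fun j => othersMean γ x'.1 i R j + σ * w j) ∈ E} := by
          have : Measurable fun w : Fin d → ℝ => fun j => othersMean γ x'.1 i R j + σ * w j := by
            fun_prop
          exact this hE
        have := pi_mixLaw_apply_le hd γ.2.1 γ.2.2 (h := c / (σ * γ * (m + 1 : ℕ))) (by positivity)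
          hL hε hA hAL hnoise₁ hnoise₂ (hbound x) (hbound x') hE'
        rwa [hexpL] at this
    _ = _ := by
        rw [lintegral_add_right _ measurable_const, lintegral_const, measure_univ, mul_one]

end SIGM

theorem proposition4 :
    ∃ K : ℝ, 0 < K ∧ ∀ δ₀ : ℝ, 0 < δ₀ → δ₀ < 1 → ∃ C : ℝ, 0 < C ∧
      ∀ (n d : ℕ) (γ : unitInterval) (c σ : ℝ),
        1 ≤ n → 1 ≤ d → 0 < (γ : ℝ) → 0 < c → 0 < σ →
        -- the error is exactly `N(0, σ² I_d)`, and independent of the selection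
        (∀ x : Fin n → Fin d → ℝ,
          (SIGM.randomnessLaw n d γ σ).map
              (fun ω => (ω.1, SIGM.output γ σ x ω - SIGM.subsampledMean γ x ω.1)) =
            (SIGM.selectionLaw n d γ).prod (SIGM.gaussianVec d σ)) ∧
        -- mean squared error
        (∀ x : SIGM.BoxData n d c,
          Integrable (SIGM.sqError γ σ x.1) (SIGM.randomnessLaw n d γ σ) ∧
          ∫ ω, SIGM.sqError γ σ x.1 ω ∂(SIGM.randomnessLaw n d γ σ) ≤
            d * c ^ 2 / (n * γ) + d * σ ^ 2) ∧
        -- a selected client's description always lies in the finite alphabet that is coded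
        (∀ (B : Fin n → Fin d → Bool) (j : Fin d),
          (SIGM.alphabet (γ : ℝ) σ c B j).Finite) ∧
        (∀ x : SIGM.BoxData n d c, ∀ᵐ ω ∂(SIGM.randomnessLaw n d γ σ), ∀ i j,
          ω.1 i j = true →
            SIGM.message γ σ x.1 ω.1 ω.2.1 i j ∈ SIGM.alphabet (γ : ℝ) σ c ω.1 j) ∧
        -- privacy and communication cost at the given noise level
        (∀ ε δ : ℝ, 0 < ε → 0 < δ → δ ≤ δ₀ → C * SIGM.noiseLevel n d γ c ε δ ≤ σ ^ 2 →
          SIGM.IsDP (SIGM.Adjacent (n := n) (d := d) (c := c))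
            (fun x => SIGM.outputLaw γ σ x.1) ε δ ∧
          ∀ i : Fin n,
            ∫ B, (SIGM.clientBits (γ : ℝ) σ c i B : ℝ) ∂(SIGM.selectionLaw n d γ) ≤
              K * (γ * d * Real.logb 2 (2 + c / (σ * √(n * γ))))) := by
  refine ⟨4, by norm_num, fun δ₀ hδ₀ hδ₀1 => ?_⟩
  -- `A` is chosen so that `L + 1 ≤ A L` for all `L ≥ log (1 / δ₀)`
  have hℓ : 0 < Real.log (1 / δ₀) := Real.log_pos ((one_lt_div hδ₀).2 hδ₀1)
  set A := 1 + 1 / Real.log (1 / δ₀) with hA_def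
  have hA : 1 ≤ A := by
    have : 0 ≤ 1 / Real.log (1 / δ₀) := by positivity
    linarith
  refine ⟨64 * Real.exp 35 * A ^ 2, by positivity, fun n d γ c σ hn hd hγ hc hσ =>
    ⟨fun x => (SIGM.measurePreserving_error hn hγ hσ x).map_eq,
      fun x => SIGM.integrable_sqError_and_integral_le hn hγ hσ x,
      fun B j => SIGM.finite_descriptions (SIGM.noise_variance_ne_zero hn hγ hσ) _,
      fun x => SIGM.ae_message_mem_alphabet hn hγ hσ x, fun ε δ hε hδ hδδ₀ hnoise => ?_⟩⟩
  have hn' : (0 : ℝ) < n := by exact_mod_cast hn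
  have hd1 : (1 : ℝ) ≤ d := by exact_mod_cast hd
  have hδ1 : δ < 1 := hδδ₀.trans_lt hδ₀1
  have hlogd : 0 ≤ Real.log d := Real.log_nonneg hd1
  have hLℓ : Real.log (1 / δ₀) ≤ Real.log (1 / δ) :=
    Real.log_le_log (by positivity) (one_div_le_one_div_of_le hδ hδδ₀)
  have hL : 0 < Real.log (1 / δ) := hℓ.trans_le hLℓ
  have hAL : Real.log (1 / δ) + 1 ≤ A * Real.log (1 / δ) := by
    have : 1 ≤ 1 / Real.log (1 / δ₀) * Real.log (1 / δ) := by
      rw [one_div, inv_mul_eq_div]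
      exact (one_le_div hℓ).2 hLℓ
    rw [hA_def, add_mul, one_mul]
    linarith
  have hD : Real.log (d / δ) = Real.log (1 / δ) + Real.log d := by
    rw [div_eq_mul_one_div, Real.log_mul (by positivity) (by positivity), add_comm]
  set C := 64 * Real.exp 35 * A ^ 2 with hC_def
  have hC : 0 < C := by positivity
  rw [SIGM.noiseLevel, hD] at hnoise
  set D := Real.log (1 / δ) + Real.log d with hD_def
  have hD0 : 0 < D := by positivity
  have hnoise₁ : C * ((c / (σ * γ * n)) ^ 2 * Real.log (1 / δ)) ≤ 1 := by
    have h₁ : C * (c ^ 2 * Real.log (1 / δ) / (n ^ 2 * (γ : ℝ) ^ 2)) ≤ σ ^ 2 := by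
      refine le_trans ?_ hnoise
      gcongr
      exact le_add_of_nonneg_right (by positivity)
    calc _ = C * (c ^ 2 * Real.log (1 / δ) / (n ^ 2 * (γ : ℝ) ^ 2)) / σ ^ 2 := by field_simp
      _ ≤ 1 := (div_le_one (by positivity)).2 h₁
  have hnoise₂ : C * ((γ * (c / (σ * γ * n))) ^ 2 * d * (D + ε) * D) ≤ ε ^ 2 := by
    have h₁ : C * (c ^ 2 * d * (D + ε) * D / (n ^ 2 * ε ^ 2)) ≤ σ ^ 2 := by
      refine le_trans ?_ hnoise
      gcongr
      exact le_add_of_nonneg_left (by positivity)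
    calc _ = C * (c ^ 2 * d * (D + ε) * D / (n ^ 2 * ε ^ 2)) / σ ^ 2 * ε ^ 2 := by field_simp
      _ ≤ 1 * ε ^ 2 := by
          gcongr
          exact (div_le_one (by positivity)).2 h₁
      _ = _ := one_mul _
  refine ⟨SIGM.isDP_outputLaw hn hd hγ hc hσ hε hδ hδ1 hA hAL hnoise₁ hnoise₂, fun i =>
    SIGM.integral_clientBits_le hn hγ hc hσ ?_ i⟩
  have hCL : 1 ≤ C * Real.log (1 / δ) := by
    have h₁ : 1 ≤ A * Real.log (1 / δ) := by linarith
    have h₂ : 1 ≤ Real.exp 35 := Real.one_le_exp (by norm_num)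
    have h₃ : 1 ≤ 64 * Real.exp 35 * A := by nlinarith
    calc (1 : ℝ) ≤ 64 * Real.exp 35 * A * (A * Real.log (1 / δ)) := one_le_mul_of_one_le_of_one_le h₃ h₁
      _ = _ := by ring
  have h0 : 0 ≤ c / (σ * γ * n) := by positivity
  have : (c / (σ * γ * n)) ^ 2 ≤ 1 := by
    calc _ ≤ (c / (σ * γ * n)) ^ 2 * (C * Real.log (1 / δ)) := le_mul_of_one_le_right (sq_nonneg _) hCL
      _ = C * ((c / (σ * γ * n)) ^ 2 * Real.log (1 / δ)) := by ring
      _ ≤ 1 := hnoise₁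
  nlinarith
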